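/- Let $q$ be an odd prime power, let $\lambda$ be a divisor of $q+1$ with $2\le\lambda<q+1$, let $m=2t+1\ge 5$ with $t$ even, and let $n=\frac{q^m+1}{\lambda}$. Fix a primitive $n$-th root of unity $\beta$ in an extension field of $\mathbb F_q$, and let $m_i(x)$ be the minimal polynomial of $\beta^i$ over $\mathbb F_q$. For integers $\delta\ge 2$ and $b\ge 0$, let $\mathcal C_{(n,q,\delta,b)}$ be the cyclic (BCH) code of length $n$ over $\mathbb F_q$ with generator polynomial $\mathrm{lcm}(m_b(x),m_{b+1}(x),\ldots,m_{b+\delta-2}(x))$. A linear code $\mathcal C$ is called LCD if $\mathcal C\cap\mathcal C^\perp=\{0\}$, where $\mathcal C^\perp$ is the Euclidean dual; an $[n,k,d]$ code is a $k$-dimensional subspace of $\mathbb F_q^n$ with minimum Hamming distance $d$. Let $\delta$ be an integer with $1\le\delta-1\le\frac{2q^{t+1}+2q-1}{\lambda}$, and put $$A=\frac{q^{t+1}+1}{\lambda},\quad B=\frac{2(q^t-1)}{\lambda},\quad \epsilon=\lceil(\delta-1)(1-q^{-1})\rceil,\quad \upsilon=\Big\lfloor\frac{q-2}{\lambda}\Big\rfloor+\Big\lfloor\frac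 q\lambda\Big\rfloor,$$ $$\kappa=2A-\Big\lfloor\frac{2q+1}{\lambda}\Big\rfloor,\quad \tau=\lceil(\kappa-1)(1-q^{-1})\rceil.$$ Then $\mathcal C_{(n,q,\delta,1)}$ is an LCD code with parameters $[n,k,d\ge\delta]$, and $\mathcal C_{(n,q,\delta+1,0)}$ is an LCD code with parameters $[n,k-1,d\ge2\delta]$, where $k$ is given as follows. (1) If $2\le\delta\le A+B$, then $$k=\begin{cases}n-2m\epsilon,&2\le\delta\le A-\lfloor\frac q\lambda\rfloor;\\ n-2m\epsilon+2m\left(\delta-A+\lfloor\frac q\lambda\rfloor\right),&A-\lfloor\frac q\lambda\rfloor<\delta\le A+\lfloor\frac{q-2}\lambda\rfloor;\\ n-2m(\epsilon-\upsilon-1),&A+\lfloor\frac{q-2}\lambda\rfloor<\delta\le A+B.\end{cases}$$ (2) If $\lfloor\frac{q-3}\lambda\rfloor\ne0$ and $A+B<\delta\le A+B+\lfloor\frac{q-3}\lambda\rfloor q^t$, then for every integer $a$ with $0\le a\le\lfloor\frac{q-3}\lambda\rfloor-1$, $$k=\begin{cases}n-2m(\epsilon-\upsilon-2a-2),&\text{if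 } A+B+aq^t<\delta\le A+(a+1)q^t;\\ n-2m(\epsilon-\upsilon-2a-3),&\text{if } A+(a+1)q^t<\delta\le A+B+(a+1)q^t.\end{cases}$$ (3) Let $A+B+\lfloor\frac{q-3}\lambda\rfloor q^t<\delta\le\frac{2q^{t+1}+2q-1}\lambda+1$. (i) If $\lfloor\frac{q-1}\lambda\rfloor=\lfloor\frac{q-3}\lambda\rfloor$, then $$k=\begin{cases}n-2m(\epsilon-\upsilon-2\lfloor\frac{q-1}\lambda\rfloor-2),&\text{if }\delta\le\kappa;\\ n-2m(\tau-\upsilon-2\lfloor\frac{q-1}\lambda\rfloor-2),&\text{if }\delta>\kappa.\end{cases}$$ (ii) If $\lfloor\frac{q-1}\lambda\rfloor=\lfloor\frac{q-3}\lambda\rfloor+1$, then $$k=\begin{cases}n-2m(\epsilon-\upsilon-2\lfloor\frac{q-1}\lambda\rfloor),&\text{if }\delta\le A+\lfloor\frac{q-1}\lambda\rfloor q^t;\\ n-2m(\epsilon-\upsilon-2\lfloor\frac{q-1}\lambda\rfloor-1),&\text{if }A+\lfloor\frac{q-1}\lambda\rfloor q^t<\delta\le\kappa;\\ n-2m(\tau-\upsilon-2\lfloor\frac{q-1}\lambda\rfloor-1),&\text{if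 }\delta>\kappa.\end{cases}$$ -/

import Mathlib

open Polynomial

noncomputable section

/-- The vector `(c₀, …, c_{n-1})` read as the class of `c₀ + c₁ X + ⋯ + c_{n-1} X^(n-1)`
in `F[X] / (X ^ n - 1)`. -/
def toQuotient (F : Type*) [Field F] (n : ℕ) :
    (Fin n → F) →ₗ[F] (F[X] ⧸ Ideal.span {(X ^ n - 1 : F[X])}) :=
  (Ideal.Quotient.mkₐ F (Ideal.span {(X ^ n - 1 : F[X])})).toLinearMap ∘ₗ
    Fintype.linearCombination F (fun i : Fin n => (X ^ (i : ℕ) : F[X]))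

/-- The cyclic code `⟨g(x)⟩` of length `n` over `F`: the vectors whose class in
`F[X] / (X ^ n - 1)` lies in the ideal generated by the class of `g`. -/
def cyclicCode {F : Type*} [Field F] (n : ℕ) (g : F[X]) : Submodule F (Fin n → F) :=
  Submodule.comap (toQuotient F n)
    ((Ideal.span {Ideal.Quotient.mk (Ideal.span {(X ^ n - 1 : F[X])}) g}).restrictScalars F)

open Classical in
/-- The monic least common multiple of the minimal polynomials over `F` of
`β ^ b, β ^ (b + 1), …, β ^ (b + δ - 2)`. -/
def bchGenerator (F : Type*) [Field F] {K : Type*} [Field K] [Algebra F K]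
    (β : K) (δ b : ℕ) : F[X] :=
  letI : NormalizedGCDMonoid F[X] := UniqueFactorizationMonoid.toNormalizedGCDMonoid F[X]
  (Finset.range (δ - 1)).lcm (fun j => minpoly F (β ^ (b + j)))

/-- The BCH code of length `n` over `F` with designed distance `δ` and offset `b`, with respect
to the `n`-th root of unity `β`. -/
def bchCode (F : Type*) [Field F] {K : Type*} [Field K] [Algebra F K]
    (n : ℕ) (β : K) (δ b : ℕ) : Submodule F (Fin n → F) :=
  cyclicCode n (bchGenerator F β δ b)

/-- The Euclidean dual code. -/
def dualCode {F : Type*} [Field F] {n : ℕ} (C : Submodule F (Fin n → F)) :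
    Submodule F (Fin n → F) where
  carrier := {b | ∀ c ∈ C, b ⬝ᵥ c = 0}
  zero_mem' := fun c _ => zero_dotProduct c
  add_mem' := fun {a b} ha hb c hc => by rw [add_dotProduct, ha c hc, hb c hc, add_zero]
  smul_mem' := fun r a ha c hc => by rw [smul_dotProduct, ha c hc, smul_zero]

/-- Linear codes with complementary dual. -/
def IsLCD {F : Type*} [Field F] {n : ℕ} (C : Submodule F (Fin n → F)) : Prop :=
  C ⊓ dualCode C = ⊥

open Classical in
/-- `d` is the minimum Hamming distance of `C` (which then has at least two codewords). -/
def IsMinDistance {F : Type*} [Field F] {n : ℕ} (C : Submodule F (Fin n → F)) (d : ℕ) : Prop :=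
  IsLeast {w : ℕ | ∃ x ∈ C, ∃ y ∈ C, x ≠ y ∧ hammingDist x y = w} d

/-- `C` is an `[n, k, d]` linear code. -/
def HasParameters {F : Type*} [Field F] {n : ℕ} (C : Submodule F (Fin n → F))
    (k : ℤ) (d : ℕ) : Prop :=
  (Module.finrank F C : ℤ) = k ∧ IsMinDistance C d

end

/-! Write `N = q^m + 1`, `Q = q^t`, `D = δ - 1`. The degree of the generator polynomial is the
number of residues modulo `n` in the `q`-cyclotomic cosets of `1, …, D`. In the given range each of
these cosets has the full size `2m`, so `k = n - 2m * numLeaders q n D` and everything reduces to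
counting coset leaders in `[1, D]` (`bchCode_parameters`).

Multiplication by `λ` turns congruence modulo `n` into congruence modulo `N`, where `q^m` acts as
`-1`. Up to sign and exchange of `x` and `y`, an equivalence is therefore `q^j x ≡ ± y` with `j ≤ t`
(`exists_small_exponent`). For `j < t` the numbers are too small to wrap around `N`, so `y` is just
a power of `q` times `x`. For `j = t` the only other possibility is a wrap by `N` or `2N`, which
pairs numbers near `qQ` or `2qQ` with numbers near multiples of `Q`. Among numbers prime to `q`, the
non-leaders are thus those near `qQ`, those of the form `cQ ± 1` with `q < c < 2q`, and all those
above `2qQ - 2q` (`exists_lt_dvd_iff_isExceptional`).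

Since `q ≡ -1` and, `t` being even, `Q ≡ 1` modulo `λ`, the multiples of `λ` among these form a
block around `A`, the progressions `A + B + jQ` and `A + jQ`, and everything from `κ` on
(`isExceptional_mul_iff`). Below `κ`, removing them and the multiples of `q` gives the count
(`numLeaders_add`); from `κ` on the count is constant, which is why `τ` replaces `ε`.

The other claims also come from `q^m ≡ -1` modulo `n`: zero sets of codewords are closed under
inversion. This makes the codes LCD and gives the second code `2δ - 1` consecutive zeros for the BCH
bound. -/

/-! ### Cyclic codes as polynomials divisible by the generator -/

/-- The codeword polynomial of `c`. -/
noncomputable def wordPoly {F : Type*} [Field F] {n : ℕ} (c : Fin n → F) : F[X] :=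
  ∑ i, C (c i) * X ^ (i : ℕ)

theorem wordPoly_eq_linearCombination {F : Type*} [Field F] {n : ℕ} (c : Fin n → F) :
    Fintype.linearCombination F (fun i : Fin n => (X ^ (i : ℕ) : F[X])) c = wordPoly c := by
  simp [Fintype.linearCombination_apply, wordPoly, smul_eq_C_mul]

theorem mem_cyclicCode_iff {F : Type*} [Field F] {n : ℕ} {g : F[X]} (hg : g ∣ X ^ n - 1)
    (c : Fin n → F) : c ∈ cyclicCode n g ↔ g ∣ wordPoly c := by
  have : toQuotient F n c = Ideal.Quotient.mk (Ideal.span {(X ^ n - 1 : F[X])}) (wordPoly c) := by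
    simp [toQuotient, wordPoly_eq_linearCombination]
  rw [cyclicCode, Submodule.mem_comap, Submodule.restrictScalars_mem, this,
    Ideal.mem_span_singleton]
  constructor
  · rintro ⟨a, ha⟩
    obtain ⟨a, rfl⟩ := Ideal.Quotient.mk_surjective a
    rw [← map_mul, Ideal.Quotient.eq, Ideal.mem_span_singleton] at ha
    have := (hg.trans ha).add (dvd_mul_right g a)
    simpa using this
  · rintro ⟨a, ha⟩
    exact ⟨Ideal.Quotient.mk _ a, by rw [ha, map_mul]⟩

/-- Rank-nullity for reduction of codeword polynomials modulo `g`: the kernel is the code and the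
image is all of `F[X] / (g)`, of dimension `deg g`. -/
theorem finrank_cyclicCode {F : Type*} [Field F] {n : ℕ} {g : F[X]}
    (hn : 0 < n) (hg : g ∣ X ^ n - 1) :
    Module.finrank F (cyclicCode n g) + g.natDegree = n := by
  have hX : (X ^ n - 1 : F[X]).Monic := monic_X_pow_sub_C 1 hn.ne'
  have hg0 : g ≠ 0 := fun h => hX.ne_zero (zero_dvd_iff.1 (h ▸ hg))
  let f : (Fin n → F) →ₗ[F] (F[X] ⧸ Ideal.span {g}) :=
    (Ideal.Quotient.mkₐ F (Ideal.span {g})).toLinearMap ∘ₗ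
      Fintype.linearCombination F (fun i : Fin n => (X ^ (i : ℕ) : F[X]))
  have hf : ∀ c, f c = Ideal.Quotient.mk (Ideal.span {g}) (wordPoly c) := fun c => by
    simp [f, wordPoly_eq_linearCombination]
  have hker : LinearMap.ker f = cyclicCode n g := by
    ext c
    rw [LinearMap.mem_ker, hf, Ideal.Quotient.eq_zero_iff_mem, Ideal.mem_span_singleton,
      mem_cyclicCode_iff hg]
  have hsurj : Function.Surjective f := by
    intro y
    obtain ⟨p, rfl⟩ := Ideal.Quotient.mk_surjective y
    -- The remainder modulo `X ^ n - 1` has degree below `n` and is congruent to `p` modulo `g`,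
    -- because `g` divides `X ^ n - 1`.
    refine ⟨fun i => (p %ₘ (X ^ n - 1)).coeff i, ?_⟩
    rw [hf]
    have h1 : wordPoly (fun i : Fin n => (p %ₘ (X ^ n - 1)).coeff i) = p %ₘ (X ^ n - 1) := by
      have hdeg : (p %ₘ (X ^ n - 1)).natDegree < n := by
        have := natDegree_modByMonic_lt p hX (by
          intro h
          have := congrArg natDegree h
          rw [show (1 : F[X]) = C 1 by simp, natDegree_X_pow_sub_C] at this
          simp at this
          omega)
        rwa [show (1 : F[X]) = C 1 by simp, natDegree_X_pow_sub_C] at this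
      rw [wordPoly, Fin.sum_univ_eq_sum_range
        (fun i => C ((p %ₘ (X ^ n - 1)).coeff i) * X ^ i) n]
      exact (as_sum_range_C_mul_X_pow' _ hdeg).symm
    rw [h1, Ideal.Quotient.eq, Ideal.mem_span_singleton, modByMonic_eq_sub_mul_div]
    exact hg.trans ⟨-(p /ₘ (X ^ n - 1)), by ring⟩
  have h2 := LinearMap.finrank_range_add_finrank_ker f
  rw [LinearMap.range_eq_top.2 hsurj, finrank_top, hker, finrank_quotient_span_eq_natDegree,
    Module.finrank_fin_fun] at h2
  omega

/-! ### Zeros of BCH codes, the BCH bound and the LCD property -/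

section BCH

variable {F : Type*} [Field F] {K : Type*} [Field K] [Algebra F K]

theorem bchGenerator_dvd_iff (β : K) (δ b : ℕ) (f : F[X]) :
    bchGenerator F β δ b ∣ f ↔ ∀ j < δ - 1, aeval (β ^ (b + j)) f = 0 := by
  classical
  refine (@Finset.lcm_dvd_iff _ _ _ (UniqueFactorizationMonoid.toNormalizedGCDMonoid F[X])
    _ _ _).trans ?_
  simp [minpoly.dvd_iff]

theorem bchGenerator_dvd_X_pow_sub_one {n : ℕ} {β : K} (hβ : β ^ n = 1) (δ b : ℕ) :
    bchGenerator F β δ b ∣ X ^ n - 1 := by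
  rw [bchGenerator_dvd_iff]
  intro j _
  simp [pow_right_comm, hβ]

theorem minpoly_dvd_bchGenerator (β : K) (δ b : ℕ) {j : ℕ} (hj : j < δ - 1) :
    minpoly F (β ^ (b + j)) ∣ bchGenerator F β δ b := by
  rw [minpoly.dvd_iff]
  exact (bchGenerator_dvd_iff β δ b _).1 dvd_rfl j hj

theorem aeval_bchGenerator_eq_zero_iff (β : K) (δ b : ℕ) (x : K) :
    aeval x (bchGenerator F β δ b) = 0 ↔ ∃ j < δ - 1, aeval x (minpoly F (β ^ (b + j))) = 0 := by
  constructor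
  · intro h
    have h1 : bchGenerator F β δ b ∣ ∏ j ∈ Finset.range (δ - 1), minpoly F (β ^ (b + j)) := by
      rw [bchGenerator_dvd_iff]
      intro j hj
      rw [map_prod]
      exact Finset.prod_eq_zero (Finset.mem_range.2 hj) (minpoly.aeval _ _)
    have h2 := aeval_eq_zero_of_dvd_aeval_eq_zero h1 h
    rw [map_prod, Finset.prod_eq_zero_iff] at h2
    obtain ⟨j, hj, h⟩ := h2
    exact ⟨j, Finset.mem_range.1 hj, h⟩
  · rintro ⟨j, hj, h⟩
    exact aeval_eq_zero_of_dvd_aeval_eq_zero (minpoly_dvd_bchGenerator β δ b hj) h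

theorem mem_bchCode_iff {n : ℕ} {β : K} (hβ : β ^ n = 1) (δ b : ℕ) (c : Fin n → F) :
    c ∈ bchCode F n β δ b ↔ ∀ j < δ - 1, aeval (β ^ (b + j)) (wordPoly c) = 0 := by
  rw [bchCode, mem_cyclicCode_iff (bchGenerator_dvd_X_pow_sub_one hβ δ b), bchGenerator_dvd_iff]

theorem aeval_wordPoly {n : ℕ} (c : Fin n → F) (x : K) :
    aeval x (wordPoly c) = ∑ i, algebraMap F K (c i) * x ^ (i : ℕ) := by
  simp [wordPoly]

theorem aeval_pow_card_pow [Fintype F] (f : F[X]) (x : K) (l : ℕ) :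
    aeval (x ^ Fintype.card F ^ l) f = aeval x f ^ Fintype.card F ^ l := by
  induction l with
  | zero => simp
  | succ l ih =>
    rw [pow_succ, pow_mul, pow_mul, ← ih]
    have := (aeval_algHom_apply (FiniteField.frobeniusAlgHom F K) (x ^ Fintype.card F ^ l) f)
    simpa [FiniteField.coe_frobeniusAlgHom] using this

/-- `K` may be infinite, so the argument passes to the finite field `F(β)`, whose Galois group
consists of the powers of Frobenius; conjugates are then `q^l`-th powers. -/
theorem aeval_minpoly_pow_eq_zero_iff [Fintype F] {n : ℕ} (hn : 0 < n) {β : K}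
    (hβ : IsPrimitiveRoot β n) (i z : ℕ) :
    aeval (β ^ z) (minpoly F (β ^ i)) = 0 ↔ ∃ l, β ^ z = β ^ (i * Fintype.card F ^ l) := by
  constructor
  · intro h
    have hint : IsIntegral F β := by
      refine ⟨X ^ n - 1, monic_X_pow_sub_C 1 hn.ne', ?_⟩
      simp [hβ.pow_eq_one]
    let L := IntermediateField.adjoin F {β}
    have : FiniteDimensional F L := IntermediateField.adjoin.finiteDimensional hint
    have : Finite L := Module.finite_of_finite F
    let b : L := ⟨β, IntermediateField.mem_adjoin_simple_self F β⟩
    have hb : ∀ k, ((b ^ k : L) : K) = β ^ k := fun k => rfl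
    have h1 : minpoly F (β ^ i) = minpoly F (b ^ i) := by
      rw [← hb]; exact minpoly.algebraMap_eq (algebraMap L K).injective (b ^ i)
    have h2 : aeval (b ^ z) (minpoly F (b ^ i)) = 0 := by
      apply (algebraMap L K).injective
      rw [← aeval_algebraMap_apply, map_zero, ← h1]
      exact h
    have h3 : IsConjRoot F (b ^ i) (b ^ z) :=
      isConjRoot_of_aeval_eq_zero (Algebra.IsIntegral.isIntegral _) h2
    obtain ⟨σ, hσ⟩ := isConjRoot_iff_exists_algEquiv.1 h3.symm
    obtain ⟨l, hl⟩ := (FiniteField.bijective_frobeniusAlgEquivOfAlgebraic_pow F L).2 σ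
    refine ⟨l, ?_⟩
    have h4 : (b ^ i) ^ Fintype.card F ^ (l : ℕ) = b ^ z := by
      rw [← hσ, ← hl]
      simp only [AlgEquiv.coe_pow, FiniteField.coe_frobeniusAlgEquivOfAlgebraic_iterate]
    rw [pow_mul, ← hb, ← hb, ← h4]
    rfl
  · rintro ⟨l, hl⟩
    rw [hl, pow_mul, aeval_pow_card_pow, minpoly.aeval, zero_pow (by positivity)]

theorem pow_eq_pow_iff_modEq_of_isPrimitiveRoot {n : ℕ} (hn : 0 < n) {β : K}
    (hβ : IsPrimitiveRoot β n) {i j : ℕ} : β ^ i = β ^ j ↔ i ≡ j [MOD n] := by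
  rw [← pow_mod_orderOf, ← pow_mod_orderOf β j, ← hβ.eq_orderOf]
  exact ⟨fun h => hβ.pow_inj (Nat.mod_lt _ hn) (Nat.mod_lt _ hn) h,
    fun h => by rw [show i % n = j % n from h]⟩

/-- The generator divides `X ^ n - 1`, which is separable and splits in `K`, so its degree is its
number of roots, and these are indexed by exponents modulo `n`. -/
theorem natDegree_bchGenerator [Fintype F] {n : ℕ} (hn : 0 < n) (hnF : (n : F) ≠ 0) {β : K}
    (hβ : IsPrimitiveRoot β n) (δ b : ℕ)
    [DecidablePred fun z => ∃ j < δ - 1, ∃ l, z ≡ (b + j) * Fintype.card F ^ l [MOD n]] :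
    (bchGenerator F β δ b).natDegree = ((Finset.range n).filter fun z =>
      ∃ j < δ - 1, ∃ l, z ≡ (b + j) * Fintype.card F ^ l [MOD n]).card := by
  classical
  set g := bchGenerator F β δ b
  have hg : g ∣ X ^ n - 1 := bchGenerator_dvd_X_pow_sub_one hβ.pow_eq_one δ b
  have hX : (X ^ n - 1 : F[X]) ≠ 0 := (monic_X_pow_sub_C 1 hn.ne').ne_zero
  have hsep : g.Separable := (X_pow_sub_one_separable_iff.2 hnF).of_dvd hg
  have hspl : (g.map (algebraMap F K)).Splits := by
    refine Splits.of_dvd (X_pow_sub_one_splits hβ) (monic_X_pow_sub_C 1 hn.ne').ne_zero ?_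
    simpa using Polynomial.map_dvd (algebraMap F K) hg
  have hg0 : g.map (algebraMap F K) ≠ 0 := by
    rw [Polynomial.map_ne_zero_iff (algebraMap F K).injective]
    rintro h
    exact hX (zero_dvd_iff.1 (h ▸ hg))
  rw [← natDegree_map (algebraMap F K), hspl.natDegree_eq_card_roots,
    ← Multiset.toFinset_card_of_nodup (nodup_roots hsep.map)]
  symm
  refine Finset.card_bij (fun z _ => β ^ z) ?_ ?_ ?_
  · intro z hz
    obtain ⟨-, j, hj, l, hl⟩ := Finset.mem_filter.1 hz
    rw [Multiset.mem_toFinset, mem_roots hg0, IsRoot, eval_map_algebraMap,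
      aeval_bchGenerator_eq_zero_iff]
    exact ⟨j, hj, (aeval_minpoly_pow_eq_zero_iff hn hβ _ _).2
      ⟨l, (pow_eq_pow_iff_modEq_of_isPrimitiveRoot hn hβ).2 hl⟩⟩
  · intro z hz w hw h
    exact hβ.pow_inj (Finset.mem_range.1 (Finset.mem_filter.1 hz).1)
      (Finset.mem_range.1 (Finset.mem_filter.1 hw).1) h
  · intro x hx
    rw [Multiset.mem_toFinset, mem_roots hg0, IsRoot, eval_map_algebraMap] at hx
    have hxn : x ^ n = 1 := by
      have := aeval_eq_zero_of_dvd_aeval_eq_zero hg hx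
      simpa [sub_eq_zero] using this
    have : NeZero n := ⟨hn.ne'⟩
    obtain ⟨z, hz, rfl⟩ := hβ.eq_pow_of_pow_eq_one hxn
    rw [aeval_bchGenerator_eq_zero_iff] at hx
    obtain ⟨j, hj, hx⟩ := hx
    obtain ⟨l, hl⟩ := (aeval_minpoly_pow_eq_zero_iff hn hβ _ _).1 hx
    refine ⟨z, Finset.mem_filter.2 ⟨Finset.mem_range.2 hz, j, hj, l, ?_⟩, rfl⟩
    exact (pow_eq_pow_iff_modEq_of_isPrimitiveRoot hn hβ).1 hl

/-- The BCH bound. -/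
theorem lt_hammingNorm_of_consecutive_zeros {n : ℕ} {β : K} (hβ : IsPrimitiveRoot β n)
    {c : Fin n → F} [DecidableEq F] (hc : c ≠ 0) (γ : K) (hγ : γ ≠ 0) (N : ℕ)
    (h : ∀ l < N, ∑ i, algebraMap F K (c i) * (γ ^ (i : ℕ) * (β ^ (i : ℕ)) ^ l) = 0) :
    N < hammingNorm c := by
  by_contra! hN
  obtain ⟨i0, hi0⟩ := Function.ne_iff.1 hc
  set S := Finset.univ.filter fun i => c i ≠ 0 with hS
  have hi0S : i0 ∈ S := by simpa [hS] using hi0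
  -- `P` kills every support position except `i0`, and its degree is below `N` when the weight is at
  -- most `N`. Combining the `N` vanishing sums with the coefficients of `P` leaves a single nonzero
  -- term.
  let P : K[X] := ∏ i ∈ S.erase i0, (X - C (β ^ (i : ℕ)))
  have hdeg : P.natDegree < N := by
    have : P.natDegree = (S.erase i0).card := by
      simp only [P]
      rw [natDegree_prod_of_monic _ _ (fun i _ => monic_X_sub_C _)]
      simp only [natDegree_X_sub_C, Finset.sum_const, smul_eq_mul, mul_one]
    rw [this, Finset.card_erase_of_mem hi0S]
    have h1 : hammingNorm c = S.card := rfl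
    have h2 : 0 < S.card := Finset.card_pos.2 ⟨_, hi0S⟩
    omega
  have h0 : ∑ i, algebraMap F K (c i) * (γ ^ (i : ℕ) * P.eval (β ^ (i : ℕ))) = 0 := by
    simp_rw [eval_eq_sum_range' hdeg, Finset.mul_sum]
    rw [Finset.sum_comm]
    refine Finset.sum_eq_zero fun l hl => ?_
    rw [← mul_zero (P.coeff l), ← h l (Finset.mem_range.1 hl), Finset.mul_sum]
    exact Finset.sum_congr rfl fun i _ => by ring
  rw [Finset.sum_eq_single i0] at h0
  · have h1 : P.eval (β ^ (i0 : ℕ)) ≠ 0 := by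
      simp only [P, eval_prod, eval_sub, eval_X, eval_C]
      rw [Finset.prod_ne_zero_iff]
      intro i hi h
      have := hβ.pow_inj i0.2 i.2 (sub_eq_zero.1 h)
      exact (Finset.mem_erase.1 hi).1 (Fin.ext this.symm)
    have h2 : algebraMap F K (c i0) ≠ 0 := by
      exact (_root_.map_ne_zero _).2 hi0
    exact mul_ne_zero h2 (mul_ne_zero (pow_ne_zero _ hγ) h1) h0
  · intro i _ hi
    by_cases hci : c i = 0
    · simp [hci]
    · have : P.eval (β ^ (i : ℕ)) = 0 := by
        simp only [P, eval_prod]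
        exact Finset.prod_eq_zero (i := i) (by simp [hS, hi, hci]) (by simp)
      simp [this]
  · simp

theorem inv_eq_pow_of_dvd_add_one {n Q : ℕ} (h : n ∣ Q + 1) {x : K} (hx : x ^ n = 1) :
    x⁻¹ = x ^ Q := by
  obtain ⟨k, hk⟩ := h
  have : x ^ Q * x = 1 := by rw [← pow_succ, hk, pow_mul, hx, one_pow]
  exact (eq_inv_of_mul_eq_one_left this).symm

/-- On `n`-th roots of unity inversion is a power of Frobenius, as `q ^ M ≡ -1` modulo `n`. -/
theorem aeval_inv_eq_zero [Fintype F] {n M : ℕ} (h : n ∣ Fintype.card F ^ M + 1) {x : K}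
    (hx : x ^ n = 1) {f : F[X]} (hf : aeval x f = 0) : aeval x⁻¹ f = 0 := by
  rw [inv_eq_pow_of_dvd_add_one h hx, aeval_pow_card_pow, hf, zero_pow (by positivity)]

theorem pow_val_add {n : ℕ} {x : K} (hx : x ^ n = 1) (i j : Fin n) :
    x ^ ((i + j : Fin n) : ℕ) = x ^ (i : ℕ) * x ^ (j : ℕ) := by
  rw [Fin.val_add, ← pow_add]
  conv_rhs => rw [← Nat.mod_add_div (i + j : ℕ) n, pow_add, pow_mul, hx, one_pow, mul_one]

theorem aeval_wordPoly_reflect {n : ℕ} [NeZero n] (c : Fin n → F) (s : Fin n) {x : K}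
    (hx : x ^ n = 1) :
    aeval x (wordPoly fun i => c (s - i)) = x ^ (s : ℕ) * aeval x⁻¹ (wordPoly c) := by
  have hx0 : x ≠ 0 := by
    rintro rfl
    rw [zero_pow (NeZero.ne n)] at hx
    exact zero_ne_one hx
  rw [aeval_wordPoly, aeval_wordPoly, Finset.mul_sum, ← Equiv.sum_comp (Equiv.subLeft s)]
  refine Finset.sum_congr rfl fun i _ => ?_
  have h1 := pow_val_add hx (s - i) i
  rw [sub_add_cancel] at h1
  rw [Equiv.subLeft_apply, sub_sub_cancel, h1, inv_pow]
  field_simp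

/-- Zeros being closed under inversion, all reflected shifts `i ↦ c (s - i)` of a codeword are
codewords. If `c` is also in the dual, its cyclic convolution with itself vanishes, and the
transform of that convolution at `β ^ j` is the square of the value of `c` there. So `c` vanishes at
every power of `β`. -/
theorem isLCD_bchCode [Fintype F] {n M : ℕ} (hn : 0 < n) (h : n ∣ Fintype.card F ^ M + 1) {β : K}
    (hβ : IsPrimitiveRoot β n) (δ b : ℕ) : IsLCD (bchCode F n β δ b) := by
  classical
  have : NeZero n := ⟨hn.ne'⟩
  rw [IsLCD, eq_bot_iff]
  rintro c ⟨hc, hc'⟩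
  have hroot : ∀ i, (β ^ i) ^ n = 1 := fun i => by rw [pow_right_comm, hβ.pow_eq_one, one_pow]
  have hconv : ∀ s, ∑ i, c i * c (s - i) = 0 := fun s => by
    refine hc' (fun i => c (s - i)) ?_
    rw [SetLike.mem_coe, mem_bchCode_iff hβ.pow_eq_one] at hc
    rw [mem_bchCode_iff hβ.pow_eq_one]
    intro j hj
    rw [aeval_wordPoly_reflect c s (hroot _), aeval_inv_eq_zero h (hroot _) (hc j hj), mul_zero]
  have hz : ∀ j, aeval (β ^ j) (wordPoly c) = 0 := fun j => by
    have h2 : aeval (β ^ j) (wordPoly c) * aeval (β ^ j) (wordPoly c) = 0 := by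
      rw [aeval_wordPoly, Finset.sum_mul_sum]
      have h3 : ∀ i : Fin n, ∑ k : Fin n, algebraMap F K (c i) * (β ^ j) ^ (i : ℕ) *
          (algebraMap F K (c k) * (β ^ j) ^ (k : ℕ)) =
          ∑ s : Fin n, algebraMap F K (c i * c (s - i)) * (β ^ j) ^ (s : ℕ) := fun i => by
        rw [← Equiv.sum_comp (Equiv.subRight i)]
        refine Finset.sum_congr rfl fun s _ => ?_
        have h1 := pow_val_add (hroot j) (s - i) i
        rw [sub_add_cancel] at h1
        rw [Equiv.subRight_apply, h1, map_mul]
        ring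
      simp_rw [h3]
      rw [Finset.sum_comm]
      refine Finset.sum_eq_zero fun s _ => ?_
      rw [← Finset.sum_mul, ← map_sum, hconv, map_zero, zero_mul]
    exact mul_self_eq_zero.1 h2
  rw [Submodule.mem_bot]
  by_contra hc0
  -- With `n` consecutive zeros the BCH bound would force a weight larger than the length.
  have := lt_hammingNorm_of_consecutive_zeros hβ hc0 1 one_ne_zero n fun l _ => by
    rw [← hz l, aeval_wordPoly]
    refine Finset.sum_congr rfl fun i _ => ?_
    rw [one_pow, one_mul, pow_right_comm]
  have h4 := hammingNorm_le_card_fintype (x := c)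
  rw [Fintype.card_fin] at h4
  omega

theorem le_hammingNorm_bchCode {n : ℕ} {β : K} (hn : 0 < n) (hβ : IsPrimitiveRoot β n)
    {δ b : ℕ} [DecidableEq F] {c : Fin n → F} (hc : c ∈ bchCode F n β δ b) (hc0 : c ≠ 0) :
    δ ≤ hammingNorm c := by
  have hβ0 : β ≠ 0 := hβ.ne_zero hn.ne'
  have := lt_hammingNorm_of_consecutive_zeros hβ hc0 (β ^ b) (pow_ne_zero _ hβ0) (δ - 1)
    fun l hl => by
      rw [← (mem_bchCode_iff hβ.pow_eq_one δ b c).1 hc l hl, aeval_wordPoly]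
      refine Finset.sum_congr rfl fun i _ => ?_
      ring
  omega

/-- The zeros `0, …, δ - 1` together with their negatives form the run `-(δ - 1), …, δ - 1` of
length `2δ - 1`; the BCH bound is applied from its left end. -/
theorem two_mul_le_hammingNorm_bchCode [Fintype F] {n M : ℕ} {β : K} (hn : 0 < n)
    (hβ : IsPrimitiveRoot β n) (h : n ∣ Fintype.card F ^ M + 1)
    {δ : ℕ} (hδ : 1 ≤ δ) [DecidableEq F] {c : Fin n → F} (hc : c ∈ bchCode F n β (δ + 1) 0)
    (hc0 : c ≠ 0) : 2 * δ ≤ hammingNorm c := by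
  have hβ0 : β ≠ 0 := hβ.ne_zero hn.ne'
  rw [mem_bchCode_iff hβ.pow_eq_one] at hc
  have := lt_hammingNorm_of_consecutive_zeros hβ hc0 ((β ^ (δ - 1))⁻¹)
    (inv_ne_zero (pow_ne_zero _ hβ0)) (2 * δ - 1) fun l hl => by
      have key : aeval ((β ^ (δ - 1))⁻¹ * β ^ l) (wordPoly c) = 0 := by
        rcases le_total (δ - 1) l with hl' | hl'
        · obtain ⟨k, rfl⟩ := Nat.exists_eq_add_of_le hl'
          rw [pow_add, inv_mul_cancel_left₀ (pow_ne_zero _ hβ0)]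
          simpa using hc k (by omega)
        · obtain ⟨k, hk⟩ := Nat.exists_eq_add_of_le hl'
          rw [hk, pow_add, mul_inv, mul_right_comm, inv_mul_cancel₀ (pow_ne_zero _ hβ0), one_mul]
          refine aeval_inv_eq_zero h (by rw [pow_right_comm, hβ.pow_eq_one, one_pow]) ?_
          simpa using hc k (by omega)
      rw [← key, aeval_wordPoly]
      refine Finset.sum_congr rfl fun i _ => ?_
      rw [mul_pow, pow_right_comm β]
  omega

theorem exists_isMinDistance {n : ℕ} (C : Submodule F (Fin n → F)) (hC : C ≠ ⊥) (N : ℕ)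
    (h : ∀ c ∈ C, c ≠ 0 → ∀ _ : DecidableEq F, N ≤ hammingNorm c) :
    ∃ d, N ≤ d ∧ IsMinDistance C d := by
  classical
  obtain ⟨c, hc, hc0⟩ := Submodule.exists_mem_ne_zero_of_ne_bot hC
  have hne : {w : ℕ | ∃ x ∈ C, ∃ y ∈ C, x ≠ y ∧ hammingDist x y = w}.Nonempty :=
    ⟨_, c, hc, 0, C.zero_mem, hc0, rfl⟩
  have hmem := Nat.sInf_mem hne
  refine ⟨sInf {w : ℕ | ∃ x ∈ C, ∃ y ∈ C, x ≠ y ∧ hammingDist x y = w}, ?_, ?_⟩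
  · obtain ⟨x, hx, y, hy, hxy, hw⟩ := hmem
    rw [← hw, hammingDist_eq_hammingNorm]
    refine h _ (C.add_mem (C.neg_mem hx) hy) (fun h0 => hxy ?_) _
    exact neg_add_eq_zero.1 h0
  · constructor
    · convert hmem
    · intro w hw
      refine Nat.sInf_le ?_
      convert hw

end BCH

/-! ### Congruences `P x ≡ ± y` modulo `q Q² + 1` between small numbers -/

/-- `y` is `± x * q ^ t` up to one or two multiples of `q ^ (2t+1) + 1`, where `Q = q ^ t`. -/
def IsWrap (q Q x y : ℤ) : Prop :=
  Q * x - y = q * Q ^ 2 + 1 ∨ Q * x - y = 2 * (q * Q ^ 2 + 1) ∨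
    Q * x + y = q * Q ^ 2 + 1 ∨ Q * x + y = 2 * (q * Q ^ 2 + 1)

section Wrap

variable {q Q : ℤ}

/-- With `P ≤ Q / q` the left side is about `2Q²`, below `q Q²` because `q ≥ 3`. Hence multipliers
smaller than `Q` never wrap around the modulus. -/
theorem mul_add_lt_of_mul_le (hq : 3 ≤ q) (hQ : q * q ≤ Q) {P x y : ℤ} (hP : 1 ≤ P)
    (hPQ : q * P ≤ Q) (hxX : x ≤ 2 * q * Q + 2 * q - 1)
    (hyX : y ≤ 2 * q * Q + 2 * q - 1) : P * x + y < q * Q ^ 2 + 1 := by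
  have hQ9 : 9 ≤ Q := by nlinarith
  have h1 : P * x ≤ P * (2 * q * Q + 2 * q - 1) := mul_le_mul_of_nonneg_left hxX (by omega)
  have h2 : (q * P) * (2 * Q + 2) ≤ Q * (2 * Q + 2) :=
    mul_le_mul_of_nonneg_right hPQ (by nlinarith)
  have h3 : (q - 3) * (Q * Q) ≥ (q - 3) * (9 * Q) :=
    mul_le_mul_of_nonneg_left (by nlinarith) (by omega)
  have h4 : Q * Q ≥ 9 * Q := mul_le_mul_of_nonneg_right hQ9 (by omega)
  nlinarith

theorem eq_of_dvd_mul_sub (hq : 3 ≤ q) (hQ : q * q ≤ Q) {P x y : ℤ} (hP : 1 ≤ P)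
    (hPQ : q * P ≤ Q) (hx : 1 ≤ x) (hy : 1 ≤ y) (hxX : x ≤ 2 * q * Q + 2 * q - 1)
    (hyX : y ≤ 2 * q * Q + 2 * q - 1) (h : q * Q ^ 2 + 1 ∣ P * x - y) : P * x = y := by
  have h1 := mul_add_lt_of_mul_le hq hQ hP hPQ hxX hyX
  have h2 : 1 ≤ P * x := by nlinarith
  have := Int.eq_zero_of_abs_lt_dvd h (by rw [abs_lt]; constructor <;> linarith)
  linarith

theorem not_dvd_mul_add (hq : 3 ≤ q) (hQ : q * q ≤ Q) {P x y : ℤ} (hP : 1 ≤ P)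
    (hPQ : q * P ≤ Q) (hx : 1 ≤ x) (hy : 1 ≤ y) (hxX : x ≤ 2 * q * Q + 2 * q - 1)
    (hyX : y ≤ 2 * q * Q + 2 * q - 1) : ¬ q * Q ^ 2 + 1 ∣ P * x + y := by
  intro h
  have h1 := mul_add_lt_of_mul_le hq hQ hP hPQ hxX hyX
  have h2 : 1 ≤ P * x := by nlinarith
  have := Int.eq_zero_of_abs_lt_dvd h (by rw [abs_lt]; constructor <;> linarith)
  linarith

/-- For the multiplier `Q` itself, this leaves only wraps by one or two times the modulus. -/
theorem mul_add_lt_three_mul (hq : 3 ≤ q) (hQ : q * q ≤ Q) {x y : ℤ}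
    (hxX : x ≤ 2 * q * Q + 2 * q - 1)
    (hyX : y ≤ 2 * q * Q + 2 * q - 1) : Q * x + y < 3 * (q * Q ^ 2 + 1) := by
  have hQ9 : 9 ≤ Q := by nlinarith
  have h1 : Q * x ≤ Q * (2 * q * Q + 2 * q - 1) := mul_le_mul_of_nonneg_left hxX (by omega)
  have h2 : 9 * (q * Q) ≤ Q * (q * Q) := mul_le_mul_of_nonneg_right hQ9 (by nlinarith)
  have h3 : q * 9 ≤ q * Q := mul_le_mul_of_nonneg_left hQ9 (by omega)
  nlinarith

theorem lt_of_le_bound (hq : 3 ≤ q) (hQ : q * q ≤ Q) {y : ℤ}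
    (hyX : y ≤ 2 * q * Q + 2 * q - 1) : y < q * Q ^ 2 + 1 := by
  have hQ9 : 9 ≤ Q := by nlinarith
  have h2 : 9 * (q * Q) ≤ Q * (q * Q) := mul_le_mul_of_nonneg_right hQ9 (by nlinarith)
  have h3 : q * 9 ≤ q * Q := mul_le_mul_of_nonneg_left hQ9 (by omega)
  nlinarith

theorem eq_or_isWrap_of_dvd_sub (hq : 3 ≤ q) (hQ : q * q ≤ Q) {x y : ℤ} (hx : 1 ≤ x)
    (hxX : x ≤ 2 * q * Q + 2 * q - 1) (hy : 1 ≤ y)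
    (hyX : y ≤ 2 * q * Q + 2 * q - 1) (h : q * Q ^ 2 + 1 ∣ Q * x - y) :
    Q * x = y ∨ IsWrap q Q x y := by
  obtain ⟨k, hk⟩ := h
  have h1 := mul_add_lt_three_mul hq hQ hxX hyX
  have h2 := lt_of_le_bound hq hQ hyX
  have hQx : 0 < Q * x := mul_pos (by nlinarith) (by omega)
  have hN : 0 < q * Q ^ 2 + 1 := by positivity
  have hk3 : k < 3 := by
    by_contra! hc
    have := mul_le_mul_of_nonneg_left hc hN.le
    linarith
  have hk0 : -1 < k := by
    by_contra! hc
    have := mul_le_mul_of_nonneg_left hc hN.le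
    linarith
  unfold IsWrap
  obtain rfl | rfl | rfl : k = 0 ∨ k = 1 ∨ k = 2 := by omega
  · left; linarith
  · right; left; linarith
  · right; right; left; linarith

theorem isWrap_of_dvd_add (hq : 3 ≤ q) (hQ : q * q ≤ Q) {x y : ℤ} (hx : 1 ≤ x)
    (hxX : x ≤ 2 * q * Q + 2 * q - 1) (hy : 1 ≤ y)
    (hyX : y ≤ 2 * q * Q + 2 * q - 1) (h : q * Q ^ 2 + 1 ∣ Q * x + y) : IsWrap q Q x y := by
  obtain ⟨k, hk⟩ := h
  have h1 := mul_add_lt_three_mul hq hQ hxX hyX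
  have hQx : 0 < Q * x := mul_pos (by nlinarith) (by omega)
  have hN : 0 < q * Q ^ 2 + 1 := by positivity
  have hk3 : k < 3 := by
    by_contra! hc
    have := mul_le_mul_of_nonneg_left hc hN.le
    linarith
  have hk0 : 0 < k := by
    by_contra! hc
    have := mul_le_mul_of_nonneg_left hc hN.le
    linarith
  unfold IsWrap
  obtain rfl | rfl : k = 1 ∨ k = 2 := by omega
  · right; right; left; linarith
  · right; right; right; linarith

/-- The forms of the two members of a wrapped pair. -/
theorem IsWrap.exists_eq {x y : ℤ} (h : IsWrap q Q x y) :
    ∃ c, (x = q * Q + c ∧ y = c * Q - 1) ∨ (x = 2 * (q * Q) + c ∧ y = c * Q - 2) ∨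
      (x = q * Q - c ∧ y = c * Q + 1) ∨ (x = 2 * (q * Q) - c ∧ y = c * Q + 2) := by
  rcases h with h | h | h | h
  · exact ⟨x - q * Q, Or.inl ⟨by ring, by linear_combination -h⟩⟩
  · exact ⟨x - 2 * (q * Q), Or.inr (Or.inl ⟨by ring, by linear_combination -h⟩)⟩
  · exact ⟨q * Q - x, Or.inr (Or.inr (Or.inl ⟨by ring, by linear_combination h⟩))⟩
  · exact ⟨2 * (q * Q) - x, Or.inr (Or.inr (Or.inr ⟨by ring, by linear_combination h⟩))⟩

/-- Equating the two forms of a wrapped pair leaves no integer `c` compatible with the bound on `x`.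
This is what makes the cosets full-sized. -/
theorem not_isWrap_self (hq : 3 ≤ q) (hQ : q * q ≤ Q) {x : ℤ}
    (hxX : x ≤ 2 * q * Q + 2 * q - 1) : ¬ IsWrap q Q x x := by
  have hQ' : 2 * q + 3 ≤ Q := by nlinarith
  intro h
  obtain ⟨c, ⟨h1, h2⟩ | ⟨h1, h2⟩ | ⟨h1, h2⟩ | ⟨h1, h2⟩⟩ := h.exists_eq
  · rcases le_or_gt c q with hc | hc
    · nlinarith [mul_le_mul_of_nonneg_right hc (by omega : 0 ≤ Q - 1)]
    · nlinarith [mul_le_mul_of_nonneg_right (show q + 1 ≤ c by omega) (by omega : 0 ≤ Q - 1)]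
  · have hc : c ≤ 2 * q - 1 := by linarith
    nlinarith [mul_le_mul_of_nonneg_right hc (by omega : 0 ≤ Q - 1)]
  · rcases le_or_gt q c with hc | hc
    · nlinarith [mul_le_mul_of_nonneg_right hc (by omega : 0 ≤ Q + 1)]
    · nlinarith [mul_le_mul_of_nonneg_right (show c ≤ q - 1 by omega) (by omega : 0 ≤ Q + 1)]
  · rcases le_or_gt (2 * q) c with hc | hc
    · nlinarith [mul_le_mul_of_nonneg_right hc (by omega : 0 ≤ Q + 1)]
    · nlinarith [mul_le_mul_of_nonneg_right (show c ≤ 2 * q - 1 by omega) (by omega : 0 ≤ Q + 1)]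

/-- The positions at which a number prime to `q` fails to be the smallest of its class. -/
def IsExceptional (q Q y : ℤ) : Prop :=
  (q * Q - q < y ∧ y < q * Q + q) ∨ (∃ c, q + 1 ≤ c ∧ c ≤ 2 * q - 1 ∧ y = c * Q - 1) ∨
    (∃ c, q + 1 ≤ c ∧ c ≤ 2 * q - 1 ∧ y = c * Q + 1) ∨ 2 * (q * Q) - 2 * q < y

theorem IsWrap.isExceptional_right (hq : 3 ≤ q) (hQ : q * q ≤ Q) {x y : ℤ} (hy : 1 ≤ y)
    (hxy : x < y) (h : IsWrap q Q x y) : IsExceptional q Q y := by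
  have hQ' : 2 * q + 3 ≤ Q := by nlinarith
  unfold IsExceptional
  obtain ⟨c, ⟨h1, h2⟩ | ⟨h1, h2⟩ | ⟨h1, h2⟩ | ⟨h1, h2⟩⟩ := h.exists_eq
  · have hc0 : 0 < c := by
      by_contra! hc
      nlinarith
    rcases le_or_gt c q with hc | hc
    · nlinarith [mul_le_mul_of_nonneg_right hc (by omega : 0 ≤ Q)]
    rcases le_or_gt c (2 * q - 1) with hc' | hc'
    · exact Or.inr (Or.inl ⟨c, by omega, by omega, h2⟩)
    · right; right; right
      nlinarith [mul_le_mul_of_nonneg_right (show 2 * q ≤ c by omega) (by omega : 0 ≤ Q)]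
  · have hc0 : 0 < c := by
      by_contra! hc
      nlinarith
    right; right; right; linarith
  · rcases lt_or_ge c q with hc | hc
    · nlinarith [mul_le_mul_of_nonneg_right (show c ≤ q - 1 by omega) (by omega : 0 ≤ Q)]
    rcases eq_or_lt_of_le hc with rfl | hc
    · left; constructor <;> linarith
    rcases le_or_gt c (2 * q - 1) with hc' | hc'
    · exact Or.inr (Or.inr (Or.inl ⟨c, by omega, by omega, h2⟩))
    · right; right; right
      nlinarith [mul_le_mul_of_nonneg_right (show 2 * q ≤ c by omega) (by omega : 0 ≤ Q)]
  · rcases le_or_gt c (2 * q - 1) with hc' | hc'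
    · nlinarith [mul_le_mul_of_nonneg_right hc' (by omega : 0 ≤ Q)]
    · right; right; right
      nlinarith [mul_le_mul_of_nonneg_right (show 2 * q ≤ c by omega) (by omega : 0 ≤ Q)]

theorem IsWrap.isExceptional_left (hq : 3 ≤ q) (hQ : q * q ≤ Q) {x y : ℤ} (hx : 1 ≤ x)
    (hxy : x < y) (hqy : ¬ q ∣ y) (h : IsWrap q Q y x) : IsExceptional q Q y := by
  have hQ' : 2 * q + 3 ≤ Q := by nlinarith
  unfold IsExceptional
  obtain ⟨c, ⟨h1, h2⟩ | ⟨h1, h2⟩ | ⟨h1, h2⟩ | ⟨h1, h2⟩⟩ := h.exists_eq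
  · have hc0 : 0 < c := by
      by_contra! hc
      nlinarith
    have hc : c ≤ q := by
      by_contra! hc
      nlinarith [mul_le_mul_of_nonneg_right (show q + 1 ≤ c by omega) (by omega : 0 ≤ Q - 1)]
    -- The value `c = q` gives `y = q (Q + 1)`, just outside the open block around `qQ`, and is
    -- excluded only by `q ∤ y`.
    have hcq : c ≠ q := by
      rintro rfl
      exact hqy ⟨Q + 1, by rw [h1]; ring⟩
    left
    have : c < q := by omega
    constructor <;> linarith
  · have hc0 : 0 < c := by
      by_contra! hc
      nlinarith
    right; right; right; linarith
  · have hc0 : 0 ≤ c := by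
      by_contra! hc
      nlinarith
    have hc : c < q := by
      by_contra! hc
      nlinarith [mul_le_mul_of_nonneg_right hc (by omega : 0 ≤ Q + 1)]
    left; constructor <;> linarith
  · have hc : c < 2 * q := by
      by_contra! hc
      nlinarith [mul_le_mul_of_nonneg_right hc (by omega : 0 ≤ Q + 1)]
    right; right; right; linarith

theorem IsExceptional.exists_isWrap (hq : 3 ≤ q) (hQ : q * q ≤ Q) {y : ℤ}
    (hqy : ¬ q ∣ y) (hyX : y ≤ 2 * q * Q + 2 * q - 1) (h : IsExceptional q Q y) :
    ∃ x, 1 ≤ x ∧ x < y ∧ (IsWrap q Q x y ∨ IsWrap q Q y x) := by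
  have hQ' : 2 * q + 3 ≤ Q := by nlinarith
  -- Treats the blocks around `qQ` and `2qQ` together: if `y` is at distance `r` from `k q Q`, its
  -- smaller partner is `r Q + k` on the left and `r Q - k` on the right.
  have key : ∀ k : ℤ, 1 ≤ k → k ≤ 2 → k * (q * Q) - k * q < y → y < k * (q * Q) + k * q →
      ∃ x, 1 ≤ x ∧ x < y ∧ (Q * y - x = k * (q * Q ^ 2 + 1) ∨
        Q * y + x = k * (q * Q ^ 2 + 1)) := by
    intro k hk1 hk2 hy1 hy2
    rcases lt_trichotomy y (k * (q * Q)) with hc | hc | hc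
    · refine ⟨(k * (q * Q) - y) * Q + k, ?_, ?_, Or.inr (by ring)⟩
      · nlinarith
      · have : k * (q * Q) - y ≤ k * q - 1 := by linarith
        nlinarith [mul_le_mul_of_nonneg_right this (by omega : 0 ≤ Q + 1)]
    · exact absurd ⟨k * Q, by rw [hc]; ring⟩ hqy
    · refine ⟨(y - k * (q * Q)) * Q - k, ?_, ?_, Or.inl (by ring)⟩
      · nlinarith
      · have : y - k * (q * Q) ≤ k * q - 1 := by linarith
        nlinarith [mul_le_mul_of_nonneg_right this (by omega : 0 ≤ Q)]
  unfold IsWrap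
  rcases h with ⟨h1, h2⟩ | ⟨c, hc1, hc2, h⟩ | ⟨c, hc1, hc2, h⟩ | h
  · obtain ⟨x, hx, hxy, h⟩ := key 1 le_rfl (by norm_num) (by linarith) (by linarith)
    refine ⟨x, hx, hxy, Or.inr ?_⟩
    rcases h with h | h <;> simp [h]
  · refine ⟨q * Q + c, by nlinarith, ?_, Or.inl (Or.inl ?_)⟩
    · nlinarith [mul_le_mul_of_nonneg_right hc1 (by omega : 0 ≤ Q - 1)]
    · rw [h]; ring
  · refine ⟨q * Q - c, by nlinarith, ?_, Or.inl (Or.inr (Or.inr (Or.inl ?_)))⟩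
    · nlinarith [mul_le_mul_of_nonneg_right hc1 (by omega : 0 ≤ Q + 1)]
    · rw [h]; ring
  · obtain ⟨x, hx, hxy, h⟩ := key 2 (by norm_num) le_rfl (by linarith) (by linarith)
    refine ⟨x, hx, hxy, Or.inr ?_⟩
    rcases h with h | h <;> simp [h]

end Wrap

/-! ### Equivalence under multiplication by powers of `q` modulo `q^(2t+1) + 1` -/

section Conjugate

theorem modulus_eq (q : ℤ) (t : ℕ) : q ^ (2 * t + 1) + 1 = q * (q ^ t) ^ 2 + 1 := by ring

/-- A power of `q` can be replaced by one with exponent at most `t`, up to sign and exchange of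
the two sides. -/
theorem exists_small_exponent {q : ℤ} {t l : ℕ} {x y : ℤ} (hl0 : 0 < l)
    (hl : l < 2 * (2 * t + 1)) (h : q ^ (2 * t + 1) + 1 ∣ q ^ l * x - y) :
    ∃ j ≤ t, (0 < j ∧ q ^ (2 * t + 1) + 1 ∣ q ^ j * x - y) ∨
      q ^ (2 * t + 1) + 1 ∣ q ^ j * x + y ∨ (0 < j ∧ q ^ (2 * t + 1) + 1 ∣ q ^ j * y - x) ∨
      q ^ (2 * t + 1) + 1 ∣ q ^ j * y + x := by
  -- Four ranges of `l`: itself, its distance to `2t + 1` from below or above (where `q^(2t+1) ≡ -1`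
  -- flips the sign), and its distance to `2(2t + 1)`. Measuring up to the next such point exchanges
  -- `x` and `y`.
  rcases le_or_gt l t with h1 | h1
  · exact ⟨l, h1, Or.inl ⟨hl0, h⟩⟩
  rcases le_or_gt l (2 * t + 1) with h2 | h2
  · obtain ⟨j, hj⟩ := Nat.exists_eq_add_of_le h2
    refine ⟨j, by omega, Or.inr (Or.inr (Or.inr ?_))⟩
    have h3 : q ^ j * y + x = (q ^ (2 * t + 1) + 1) * x - q ^ j * (q ^ l * x - y) := by
      rw [hj, pow_add]; ring
    rw [h3]
    exact dvd_sub (dvd_mul_right _ _) (h.mul_left _)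
  obtain ⟨i, hi⟩ := Nat.exists_eq_add_of_le h2.le
  rcases le_or_gt i t with h3 | h3
  · refine ⟨i, h3, Or.inr (Or.inl ?_)⟩
    have h4 : q ^ i * x + y = (q ^ (2 * t + 1) + 1) * (q ^ i * x) - (q ^ l * x - y) := by
      rw [hi, pow_add]; ring
    rw [h4]
    exact dvd_sub (dvd_mul_right _ _) h
  · obtain ⟨j, hj⟩ := Nat.exists_eq_add_of_le (show i ≤ 2 * t + 1 by omega)
    refine ⟨j, by omega, Or.inr (Or.inr (Or.inl ⟨by omega, ?_⟩))⟩
    have h4 : q ^ j * y - x =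
        (q ^ (2 * t + 1) + 1) * ((q ^ (2 * t + 1) - 1) * x) - q ^ j * (q ^ l * x - y) := by
      have h5 : q ^ i * q ^ j = q ^ (2 * t + 1) := by rw [← pow_add, ← hj]
      rw [hi, pow_add]
      linear_combination q ^ (2 * t + 1) * x * h5
    rw [h4]
    exact dvd_sub (dvd_mul_right _ _) (h.mul_left _)

variable {q : ℤ} {t : ℕ} {x y : ℤ}

theorem sq_le_pow (hq : 3 ≤ q) (ht : 2 ≤ t) : q * q ≤ q ^ t := by
  rw [← sq]
  exact pow_le_pow_right₀ (by omega) ht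

theorem eq_mul_or_isWrap (hq : 3 ≤ q) (ht : 2 ≤ t) {l : ℕ} (hl0 : 0 < l)
    (hl : l < 2 * (2 * t + 1)) (hx : 1 ≤ x) (hxX : x ≤ 2 * q * q ^ t + 2 * q - 1)
    (hy : 1 ≤ y) (hyX : y ≤ 2 * q * q ^ t + 2 * q - 1)
    (h : q ^ (2 * t + 1) + 1 ∣ q ^ l * x - y) :
    (∃ j, 0 < j ∧ q ^ j * x = y) ∨ (∃ j, 0 < j ∧ q ^ j * y = x) ∨ IsWrap q (q ^ t) x y ∨
      IsWrap q (q ^ t) y x := by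
  have hQ := sq_le_pow hq ht
  obtain ⟨j, hj, h⟩ := exists_small_exponent hl0 hl h
  have hP : 1 ≤ q ^ j := one_le_pow₀ (by omega)
  rw [modulus_eq] at h
  rcases eq_or_lt_of_le hj with rfl | hj
  · rcases h with ⟨h0, h⟩ | h | ⟨h0, h⟩ | h
    · rcases eq_or_isWrap_of_dvd_sub hq hQ hx hxX hy hyX h with h | h
      · exact Or.inl ⟨_, h0, h⟩
      · exact Or.inr (Or.inr (Or.inl h))
    · exact Or.inr (Or.inr (Or.inl (isWrap_of_dvd_add hq hQ hx hxX hy hyX h)))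
    · rcases eq_or_isWrap_of_dvd_sub hq hQ hy hyX hx hxX h with h | h
      · exact Or.inr (Or.inl ⟨_, h0, h⟩)
      · exact Or.inr (Or.inr (Or.inr h))
    · exact Or.inr (Or.inr (Or.inr (isWrap_of_dvd_add hq hQ hy hyX hx hxX h)))
  · have hPQ : q * q ^ j ≤ q ^ t := by
      rw [← pow_succ']
      exact pow_le_pow_right₀ (by omega) hj
    rcases h with ⟨h0, h⟩ | h | ⟨h0, h⟩ | h
    · exact Or.inl ⟨j, h0, eq_of_dvd_mul_sub hq hQ hP hPQ hx hy hxX hyX h⟩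
    · exact absurd h (not_dvd_mul_add hq hQ hP hPQ hx hy hxX hyX)
    · exact Or.inr (Or.inl ⟨j, h0, eq_of_dvd_mul_sub hq hQ hP hPQ hy hx hyX hxX h⟩)
    · exact absurd h (not_dvd_mul_add hq hQ hP hPQ hy hx hyX hxX)

/-- The cyclotomic coset of a small number has full size. -/
theorem not_dvd_pow_mul_sub_self (hq : 3 ≤ q) (ht : 2 ≤ t) {l : ℕ} (hl0 : 0 < l)
    (hl : l < 2 * (2 * t + 1)) (hx : 1 ≤ x) (hxX : x ≤ 2 * q * q ^ t + 2 * q - 1) :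
    ¬ q ^ (2 * t + 1) + 1 ∣ q ^ l * x - x := by
  intro h
  have hne : ∀ j, 0 < j → q ^ j * x ≠ x := fun j hj h => by
    have : 1 < q ^ j := one_lt_pow₀ (by omega) hj.ne'
    nlinarith
  rcases eq_mul_or_isWrap hq ht hl0 hl hx hxX hx hxX h with
    ⟨j, hj, h⟩ | ⟨j, hj, h⟩ | h | h
  · exact hne j hj h
  · exact hne j hj h
  · exact not_isWrap_self hq (sq_le_pow hq ht) hxX h
  · exact not_isWrap_self hq (sq_le_pow hq ht) hxX h

theorem IsWrap.exists_dvd (h : IsWrap q (q ^ t) x y) :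
    ∃ l, q ^ (2 * t + 1) + 1 ∣ q ^ l * x - y := by
  rw [modulus_eq]
  rcases h with h | h | h | h
  · exact ⟨t, by rw [h]⟩
  · exact ⟨t, by rw [h]; exact dvd_mul_left _ _⟩
  -- The extra exponent `2t + 1` supplies the sign `-1`.
  · refine ⟨t + (2 * t + 1), x * q ^ t - 1, ?_⟩
    rw [← modulus_eq] at *
    rw [pow_add]
    linear_combination -h
  · refine ⟨t + (2 * t + 1), x * q ^ t - 2, ?_⟩
    rw [← modulus_eq] at *
    rw [pow_add]
    linear_combination -h

theorem exists_dvd_symm (h : ∃ l, q ^ (2 * t + 1) + 1 ∣ q ^ l * x - y) :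
    ∃ l, q ^ (2 * t + 1) + 1 ∣ q ^ l * y - x := by
  obtain ⟨l, h⟩ := h
  -- As `q^(4t+2) ≡ 1`, the inverse of `q^l` is `q^((4t+1) l)`.
  refine ⟨(4 * t + 1) * l, ?_⟩
  have h1 : q ^ (2 * t + 1) + 1 ∣ (q ^ (4 * t + 2)) ^ l - 1 := by
    have : q ^ (2 * t + 1) + 1 ∣ q ^ (4 * t + 2) - 1 :=
      ⟨q ^ (2 * t + 1) - 1, by ring⟩
    exact this.trans (by simpa using sub_dvd_pow_sub_pow (q ^ (4 * t + 2)) 1 l)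
  have h2 : q ^ ((4 * t + 1) * l) * y - x =
      ((q ^ (4 * t + 2)) ^ l - 1) * x - q ^ ((4 * t + 1) * l) * (q ^ l * x - y) := by
    rw [← pow_mul, show (4 * t + 2) * l = (4 * t + 1) * l + l by ring, pow_add]
    ring
  rw [h2]
  exact dvd_sub (h1.mul_right _) (h.mul_left _)

theorem exists_dvd_lt (h : ∃ l, q ^ (2 * t + 1) + 1 ∣ q ^ l * x - y) :
    ∃ l < 2 * (2 * t + 1), q ^ (2 * t + 1) + 1 ∣ q ^ l * x - y := by
  obtain ⟨l, h⟩ := h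
  refine ⟨l % (2 * (2 * t + 1)), Nat.mod_lt _ (by omega), ?_⟩
  have h1 : q ^ (2 * t + 1) + 1 ∣ (q ^ (2 * (2 * t + 1))) ^ (l / (2 * (2 * t + 1))) - 1 := by
    have : q ^ (2 * t + 1) + 1 ∣ q ^ (2 * (2 * t + 1)) - 1 :=
      ⟨q ^ (2 * t + 1) - 1, by ring⟩
    exact this.trans (by simpa using sub_dvd_pow_sub_pow (q ^ (2 * (2 * t + 1))) 1 _)
  have h2 : q ^ l = q ^ (l % (2 * (2 * t + 1))) *
      (q ^ (2 * (2 * t + 1))) ^ (l / (2 * (2 * t + 1))) := by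
    rw [← pow_mul, ← pow_add, Nat.mod_add_div]
  rw [h2] at h
  have h3 := dvd_sub h (h1.mul_left (q ^ (l % (2 * (2 * t + 1))) * x))
  have h4 : ∀ u v : ℤ, u * v * x - y - u * x * (v - 1) = u * x - y := fun u v => by ring
  rwa [h4] at h3

/-- Up to the bound, the numbers prime to `q` that are not smallest in their class are the
exceptional ones. -/
theorem exists_lt_dvd_iff_isExceptional (hq : 3 ≤ q) (ht : 2 ≤ t) (hqy : ¬ q ∣ y) (hy : 1 ≤ y)
    (hyX : y ≤ 2 * q * q ^ t + 2 * q - 1) :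
    (∃ x, 1 ≤ x ∧ x < y ∧ ∃ l, q ^ (2 * t + 1) + 1 ∣ q ^ l * x - y) ↔
      IsExceptional q (q ^ t) y := by
  have hQ := sq_le_pow hq ht
  constructor
  · rintro ⟨x, hx, hxy, h⟩
    obtain ⟨l, hl, h⟩ := exists_dvd_lt h
    rcases Nat.eq_zero_or_pos l with rfl | hl0
    · rw [pow_zero] at h
      have hq2 : 1 ≤ q ^ t := one_le_pow₀ (by omega)
      have := eq_of_dvd_mul_sub hq hQ (P := 1) le_rfl (by nlinarith) hx hy (by linarith) hyX
        (by rwa [← modulus_eq])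
      omega
    · rcases eq_mul_or_isWrap hq ht hl0 hl hx (by linarith) hy hyX h with
        ⟨j, hj, h⟩ | ⟨j, hj, h⟩ | h | h
      · exact absurd (h ▸ (dvd_pow_self q hj.ne').mul_right x) hqy
      · have : 1 < q ^ j := one_lt_pow₀ (by omega) hj.ne'
        nlinarith
      · exact h.isExceptional_right hq hQ hy hxy
      · exact h.isExceptional_left hq hQ hx hxy hqy
  · intro h
    obtain ⟨x, hx, hxy, h⟩ := h.exists_isWrap hq hQ hqy hyX
    exact ⟨x, hx, hxy, h.elim IsWrap.exists_dvd fun h => exists_dvd_symm h.exists_dvd⟩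

end Conjugate

/-! ### Cyclotomic cosets and their leaders modulo `n` -/

section Cosets

/-- The elements of `[1, D]` that are not congruent modulo `n` to `x * q ^ l` for any smaller
positive `x`. -/
def IsCosetLeader (q n s : ℕ) : Prop :=
  ∀ x, 1 ≤ x → x < s → ∀ l, ¬ s ≡ x * q ^ l [MOD n]

open Classical in
/-- The number of coset leaders in `[1, D]`. -/
noncomputable def numLeaders (q n D : ℕ) : ℕ :=
  ((Finset.Icc 1 D).filter fun s => IsCosetLeader q n s).card

variable {q n : ℕ}

theorem modEq_symm_of_pow_modEq_one {r : ℕ} (hr0 : 0 < r) (hr : q ^ r ≡ 1 [MOD n]) {x y l : ℕ}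
    (h : y ≡ x * q ^ l [MOD n]) : x ≡ y * q ^ ((r - 1) * l) [MOD n] := by
  have h1 : x * q ^ l * q ^ ((r - 1) * l) = x * (q ^ r) ^ l := by
    rw [mul_assoc, ← pow_add, ← pow_mul]
    congr 2
    obtain ⟨k, rfl⟩ := Nat.exists_eq_add_of_lt hr0
    simp
    ring
  have h2 := (h.mul_right (q ^ ((r - 1) * l))).trans (by rw [h1])
  have h3 : x * (q ^ r) ^ l ≡ x * 1 [MOD n] := ((hr.pow l).trans (by rw [one_pow])).mul_left x
  rw [mul_one] at h3
  exact (h2.trans h3).symm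

theorem exists_isCosetLeader (s : ℕ) (hs : 1 ≤ s) :
    ∃ x, 1 ≤ x ∧ x ≤ s ∧ IsCosetLeader q n x ∧ ∃ l, s ≡ x * q ^ l [MOD n] := by
  induction s using Nat.strong_induction_on with
  | _ s ih =>
    by_cases h : IsCosetLeader q n s
    · exact ⟨s, hs, le_rfl, h, 0, by rw [pow_zero, mul_one]⟩
    · unfold IsCosetLeader at h
      push Not at h
      obtain ⟨x, hx, hxs, l, hl⟩ := h
      obtain ⟨y, hy, hyx, hlead, k, hk⟩ := ih x hxs hx
      refine ⟨y, hy, by omega, hlead, k + l, hl.trans ?_⟩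
      rw [pow_add, ← mul_assoc]
      exact hk.mul_right _

/-- `(s, l) ↦ s q^l mod n` is a bijection from leaders times exponents below `r`: distinct leaders
have disjoint cosets, each coset has exactly `r` elements, and the leader of a coset meeting `[1,
D]` is itself at most `D`. -/
theorem card_biUnion_cosets {r : ℕ} (hn : 0 < n) (hcop : Nat.Coprime n q) (hr0 : 0 < r)
    (hr : q ^ r ≡ 1 [MOD n]) {D : ℕ}
    (hsize : ∀ s, 1 ≤ s → s ≤ D → ∀ l, 0 < l → l < r → ¬ s * q ^ l ≡ s [MOD n])
    [DecidablePred fun z => ∃ j < D, ∃ l, z ≡ (1 + j) * q ^ l [MOD n]] :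
    ((Finset.range n).filter fun z => ∃ j < D, ∃ l, z ≡ (1 + j) * q ^ l [MOD n]).card =
      r * numLeaders q n D := by
  classical
  rw [numLeaders, mul_comm, ← Finset.card_range r, ← Finset.card_product]
  symm
  have hinj : ∀ s, 1 ≤ s → s ≤ D → ∀ l l', l ≤ l' → l' < r → s * q ^ l ≡ s * q ^ l' [MOD n] →
      l = l' := by
    intro s hs hsD l l' hle hl' h
    obtain ⟨k, rfl⟩ := Nat.exists_eq_add_of_le hle
    by_contra hne
    refine hsize s hs hsD k (by omega) (by omega) ?_
    rw [add_comm l, pow_add, ← mul_assoc] at h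
    exact (Nat.ModEq.cancel_right_of_coprime (hcop.pow_right l) h).symm
  refine Finset.card_bij (fun p _ => (p.1 * q ^ p.2) % n) ?_ ?_ ?_
  · rintro ⟨s, l⟩ h
    simp only [Finset.mem_product, Finset.mem_filter, Finset.mem_Icc, Finset.mem_range] at h ⊢
    refine ⟨Nat.mod_lt _ hn, s - 1, by omega, l, ?_⟩
    rw [show 1 + (s - 1) = s by omega]
    exact Nat.mod_modEq _ _
  · rintro ⟨s, l⟩ h ⟨s', l'⟩ h' heq
    simp only [Finset.mem_product, Finset.mem_filter, Finset.mem_Icc, Finset.mem_range] at h h'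
    obtain ⟨⟨⟨hs1, hsD⟩, hs⟩, hl⟩ := h
    obtain ⟨⟨⟨hs1', hsD'⟩, hs'⟩, hl'⟩ := h'
    change s * q ^ l ≡ s' * q ^ l' [MOD n] at heq
    have hcls : ∀ {a b i j}, a * q ^ i ≡ b * q ^ j [MOD n] → ∃ k, b ≡ a * q ^ k [MOD n] := by
      intro a b i j h
      refine ⟨i + (r - 1) * j, ?_⟩
      rw [pow_add, ← mul_assoc]
      exact modEq_symm_of_pow_modEq_one hr0 hr h
    obtain rfl : s = s' := by
      rcases lt_trichotomy s s' with hlt | heq' | hlt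
      · obtain ⟨k, hk⟩ := hcls heq
        exact absurd hk (hs' s hs1 hlt k)
      · exact heq'
      · obtain ⟨k, hk⟩ := hcls heq.symm
        exact absurd hk (hs s' hs1' hlt k)
    rcases le_total l l' with hle | hle
    · rw [hinj s hs1 hsD l l' hle hl' heq]
    · rw [hinj s hs1 hsD l' l hle hl heq.symm]
  · intro z hz
    obtain ⟨hzn, j, hj, l, hl⟩ := Finset.mem_filter.1 hz
    obtain ⟨x, hx, hxs, hlead, k, hk⟩ := exists_isCosetLeader (q := q) (n := n) (1 + j) (by omega)
    refine ⟨(x, (k + l) % r), ?_, ?_⟩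
    · simp only [Finset.mem_product, Finset.mem_filter, Finset.mem_Icc, Finset.mem_range]
      exact ⟨⟨⟨hx, by omega⟩, hlead⟩, Nat.mod_lt _ hr0⟩
    · have h1 : z ≡ x * q ^ (k + l) [MOD n] := by
        refine hl.trans ?_
        rw [pow_add, ← mul_assoc]
        exact hk.mul_right _
      have h2 : q ^ (k + l) ≡ q ^ ((k + l) % r) [MOD n] := by
        conv_lhs => rw [← Nat.mod_add_div (k + l) r, pow_add, pow_mul]
        have := ((hr.pow ((k + l) / r)).mul_left (q ^ ((k + l) % r)))
        rwa [one_pow, mul_one] at this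
      have h3 := h1.trans (h2.mul_left x)
      exact Eq.trans h3.symm (Nat.mod_eq_of_lt (Finset.mem_range.1 hzn))

theorem card_biUnion_cosets_zero (hn : 0 < n) (hcop : Nat.Coprime n q) {D : ℕ} (hD : D < n)
    [DecidablePred fun z => ∃ j < D, ∃ l, z ≡ (1 + j) * q ^ l [MOD n]]
    [DecidablePred fun z => ∃ j < D + 1, ∃ l, z ≡ (0 + j) * q ^ l [MOD n]] :
    ((Finset.range n).filter fun z => ∃ j < D + 1, ∃ l, z ≡ (0 + j) * q ^ l [MOD n]).card =
      ((Finset.range n).filter fun z => ∃ j < D, ∃ l, z ≡ (1 + j) * q ^ l [MOD n]).card + 1 := by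
  classical
  rw [← Finset.card_insert_of_notMem (a := 0)]
  · congr 1
    ext z
    simp only [Finset.mem_filter, Finset.mem_insert, Finset.mem_range]
    constructor
    · rintro ⟨hz, j, hj, l, hl⟩
      rcases Nat.eq_zero_or_pos j with rfl | hj0
      · left
        rw [add_zero, zero_mul] at hl
        exact Nat.eq_zero_of_dvd_of_lt (Nat.modEq_zero_iff_dvd.1 hl) hz
      · exact Or.inr ⟨hz, j - 1, by omega, l, by rwa [show 1 + (j - 1) = 0 + j by omega]⟩
    · rintro (rfl | ⟨hz, j, hj, l, hl⟩)
      · exact ⟨hn, 0, by omega, 0, by simp [Nat.ModEq.refl]⟩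
      · exact ⟨hz, 1 + j, by omega, l, by rwa [zero_add]⟩
  · simp only [Finset.mem_filter, Finset.mem_range, not_and]
    rintro - ⟨j, hj, l, hl⟩
    have h1 := Nat.modEq_zero_iff_dvd.1 hl.symm
    have h2 := (hcop.pow_right l).dvd_of_dvd_mul_right h1
    have := Nat.le_of_dvd (by omega) h2
    omega

end Cosets

/-! ### Coset leaders modulo `n` seen as multiples of `λ` modulo `q^(2t+1) + 1` -/

section Leaders

variable {q lam t n : ℕ}

theorem modEq_iff_dvd_of_mul_eq (hlam : 0 < lam) (hn : lam * n = q ^ (2 * t + 1) + 1)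
    (x s l : ℕ) : s ≡ x * q ^ l [MOD n] ↔
      (q : ℤ) ^ (2 * t + 1) + 1 ∣ (q : ℤ) ^ l * ((lam * x : ℕ) : ℤ) - ((lam * s : ℕ) : ℤ) := by
  have h1 : (q : ℤ) ^ (2 * t + 1) + 1 = lam * n := by exact_mod_cast hn.symm
  rw [Nat.modEq_iff_dvd, h1]
  have h2 : (q : ℤ) ^ l * ((lam * x : ℕ) : ℤ) - ((lam * s : ℕ) : ℤ) =
      lam * (((x * q ^ l : ℕ) : ℤ) - s) := by push_cast; ring
  rw [h2, mul_dvd_mul_iff_left (by positivity)]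

theorem coprime_of_dvd_add_one (h : lam ∣ q + 1) : Nat.Coprime lam q := by
  have : Nat.Coprime (q + 1) q := by simp
  exact this.coprime_dvd_left h

theorem not_isCosetLeader_of_dvd (hq : 2 ≤ q) {s : ℕ} (hs : 1 ≤ s) (h : q ∣ s) :
    ¬ IsCosetLeader q n s := by
  obtain ⟨x, rfl⟩ := h
  have hx : 0 < x := Nat.pos_of_mul_pos_left hs
  intro hl
  exact hl x hx (by nlinarith) 1 (by rw [pow_one, mul_comm])

theorem not_isCosetLeader_iff (hq : 3 ≤ q) (ht : 2 ≤ t) (hlam0 : 0 < lam) (hlam : lam ∣ q + 1)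
    (hn : lam * n = q ^ (2 * t + 1) + 1) {s : ℕ} (hs : 1 ≤ s) (hqs : ¬ q ∣ s)
    (hsX : lam * s + 1 ≤ 2 * q * q ^ t + 2 * q) :
    ¬ IsCosetLeader q n s ↔ IsExceptional q ((q : ℤ) ^ t) (lam * s : ℕ) := by
  have hcop := coprime_of_dvd_add_one hlam
  have h1 : ¬ (q : ℤ) ∣ (lam * s : ℕ) := by
    rw [Int.natCast_dvd_natCast]
    exact fun h => hqs (hcop.symm.dvd_of_dvd_mul_left h)
  have h2 : (1 : ℤ) ≤ (lam * s : ℕ) := by exact_mod_cast Nat.mul_pos hlam0 hs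
  have h3 : ((lam * s : ℕ) : ℤ) ≤ 2 * q * (q : ℤ) ^ t + 2 * q - 1 := by
    have : ((lam * s + 1 : ℕ) : ℤ) ≤ ((2 * q * q ^ t + 2 * q : ℕ) : ℤ) := by exact_mod_cast hsX
    push_cast at this ⊢
    linarith
  rw [← exists_lt_dvd_iff_isExceptional (by exact_mod_cast hq) ht h1 h2 h3]
  unfold IsCosetLeader
  push Not
  constructor
  · rintro ⟨x, hx, hxs, l, hl⟩
    refine ⟨(lam * x : ℕ), by exact_mod_cast Nat.mul_pos hlam0 hx, ?_, l,
      (modEq_iff_dvd_of_mul_eq hlam0 hn x s l).1 hl⟩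
    exact_mod_cast Nat.mul_lt_mul_of_pos_left hxs hlam0
  · rintro ⟨y, hy, hys, l, hl⟩
    lift y to ℕ using by omega
    -- Any number equivalent to a multiple of `λ` is one too, since `λ` divides the modulus and is
    -- prime to `q`. So minimality among all numbers agrees with minimality among multiples of `λ`.
    have h4 : lam ∣ y := by
      have h5 : (lam : ℤ) ∣ (q : ℤ) ^ l * y - (lam * s : ℕ) := by
        refine Dvd.dvd.trans ⟨n, ?_⟩ hl
        exact_mod_cast hn.symm
      have h6 : (lam : ℤ) ∣ (q : ℤ) ^ l * y := by
        have := dvd_add h5 (show (lam : ℤ) ∣ (lam * s : ℕ) by push_cast; exact dvd_mul_right _ _)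
        simpa using this
      have h7 : lam ∣ q ^ l * y := by exact_mod_cast h6
      exact (hcop.pow_right l).dvd_of_dvd_mul_left h7
    obtain ⟨x, rfl⟩ := h4
    refine ⟨x, ?_, ?_, l, (modEq_iff_dvd_of_mul_eq hlam0 hn x s l).2 hl⟩
    · have : 1 ≤ lam * x := by exact_mod_cast hy
      exact Nat.pos_of_mul_pos_left this
    · exact lt_of_mul_lt_mul_left (by exact_mod_cast hys) (Nat.zero_le lam)

theorem not_mul_pow_modEq_self (hq : 3 ≤ q) (ht : 2 ≤ t) (hlam0 : 0 < lam)
    (hn : lam * n = q ^ (2 * t + 1) + 1) {s : ℕ} (hs : 1 ≤ s)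
    (hsX : lam * s + 1 ≤ 2 * q * q ^ t + 2 * q) {l : ℕ} (hl0 : 0 < l)
    (hl : l < 2 * (2 * t + 1)) : ¬ s * q ^ l ≡ s [MOD n] := by
  intro h
  refine not_dvd_pow_mul_sub_self (by exact_mod_cast hq) ht hl0 hl ?_ ?_
    ((modEq_iff_dvd_of_mul_eq hlam0 hn s s l).1 h.symm)
  · exact_mod_cast Nat.mul_pos hlam0 hs
  · have : ((lam * s + 1 : ℕ) : ℤ) ≤ ((2 * q * q ^ t + 2 * q : ℕ) : ℤ) := by exact_mod_cast hsX
    push_cast at this ⊢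
    linarith

/-- The parity of `t` enters through this fact: `q ≡ -1` modulo `λ`. -/
theorem dvd_pow_even_sub_one (hlam : lam ∣ q + 1) (ht : Even t) : (lam : ℤ) ∣ (q : ℤ) ^ t - 1 := by
  obtain ⟨k, rfl⟩ := ht
  have h1 : (q : ℤ) + 1 ∣ (q : ℤ) ^ (k + k) - 1 := by
    rw [← two_mul, pow_mul]
    have : (q : ℤ) ^ 2 - 1 ∣ ((q : ℤ) ^ 2) ^ k - 1 := by
      simpa using sub_dvd_pow_sub_pow ((q : ℤ) ^ 2) 1 k
    exact Dvd.dvd.trans ⟨(q : ℤ) - 1, by ring⟩ this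
  exact Dvd.dvd.trans (by exact_mod_cast hlam) h1

/-- The exceptional multiples of `lam`, divided by `lam`. -/
theorem isExceptional_mul_iff {q lam Q A B s : ℕ} (hq : 3 ≤ q) (hlam2 : 2 ≤ lam)
    (hlam : lam ∣ q + 1) (hQ : (lam : ℤ) ∣ (Q : ℤ) - 1) (hA : lam * A = q * Q + 1)
    (hB : lam * B + 2 = 2 * Q) :
    IsExceptional q Q (lam * s : ℕ) ↔ (A ≤ s + q / lam ∧ s ≤ A + (q - 2) / lam) ∨
      (∃ j ≤ (q - 3) / lam, s = A + B + j * Q) ∨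
      (∃ j, 1 ≤ j ∧ j ≤ (q - 1) / lam ∧ s = A + j * Q) ∨ 2 * A ≤ s + (2 * q + 1) / lam := by
  have hlam0 : 0 < lam := by omega
  have hA' : (lam : ℤ) * A = q * Q + 1 := by exact_mod_cast hA
  have hB' : (lam : ℤ) * B + 2 = 2 * Q := by exact_mod_cast hB
  have hdiv : ∀ a b c : ℕ, a ≤ b + c / lam ↔ (lam : ℤ) * a - lam * b ≤ c := by
    intro a b c
    rw [← Nat.sub_le_iff_le_add', Nat.le_div_iff_mul_le hlam0]
    rcases le_total a b with h | h
    · rw [Nat.sub_eq_zero_of_le h, zero_mul]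
      have : (lam : ℤ) * a ≤ lam * b := by exact_mod_cast Nat.mul_le_mul_left _ h
      simp only [Nat.zero_le, true_iff]
      have : (0 : ℤ) ≤ c := by positivity
      linarith
    · zify [h]
      rw [sub_mul, mul_comm (a : ℤ), mul_comm (b : ℤ)]
  have hdiv' : ∀ j c : ℕ, j ≤ c / lam ↔ (lam : ℤ) * j ≤ c := by
    intro j c
    have := hdiv j 0 c
    simpa using this
  unfold IsExceptional
  refine or_congr ?_ (or_congr ?_ (or_congr ?_ ?_))
  -- The symmetric block around `qQ` becomes lopsided around `A` because `λ A = qQ + 1`: hence `q`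
  -- on one side and `q - 2` on the other.
  · rw [hdiv, hdiv]
    push_cast [show 2 ≤ q by omega]
    constructor <;> rintro ⟨h1, h2⟩ <;> constructor <;> linarith
  · constructor
    · rintro ⟨c, hc1, hc2, h⟩
      obtain ⟨i, hi⟩ := hQ
      obtain ⟨e, he⟩ := hlam
      have he' : (q : ℤ) + 1 = lam * e := by exact_mod_cast he
      -- Modulo `λ`, `cQ - 1 ≡ c - 1 ≡ c - q - 2`.
      have h1 : (lam : ℤ) ∣ c - q - 2 :=
        ⟨s - c * i - e, by push_cast at h; linear_combination -h - c * hi - he'⟩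
      obtain ⟨j, hj⟩ := h1
      -- The bound on `c` only gives `λ j ≥ -1`; `λ ≥ 2` is needed to exclude negative `j`.
      have hj0 : 0 ≤ j := by
        by_contra! hneg
        have : (lam : ℤ) * j ≤ lam * (-1) := mul_le_mul_of_nonneg_left (by omega) (by omega)
        linarith [show (2 : ℤ) ≤ lam by exact_mod_cast hlam2]
      lift j to ℕ using hj0
      refine ⟨j, ?_, ?_⟩
      · rw [hdiv', ← hj]
        push_cast [hq]
        linarith
      · have : (lam : ℤ) * s = lam * ((A + B + j * Q : ℕ) : ℤ) := by
          push_cast at h ⊢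
          linear_combination h - hA' - hB' + Q * hj
        exact_mod_cast mul_left_cancel₀ (by positivity) this
    · rintro ⟨j, hj, rfl⟩
      rw [hdiv'] at hj
      push_cast [hq] at hj
      refine ⟨q + 2 + lam * j, ?_, ?_, ?_⟩
      · have : (0 : ℤ) ≤ lam * j := by positivity
        linarith
      · linarith
      · push_cast
        linear_combination hA' + hB'
  · constructor
    · rintro ⟨c, hc1, hc2, h⟩
      obtain ⟨i, hi⟩ := hQ
      obtain ⟨e, he⟩ := hlam
      have he' : (q : ℤ) + 1 = lam * e := by exact_mod_cast he
      -- Modulo `λ`, `cQ + 1 ≡ c + 1 ≡ c - q`.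
      have h1 : (lam : ℤ) ∣ c - q :=
        ⟨s - c * i - e, by push_cast at h; linear_combination -h - c * hi - he'⟩
      obtain ⟨j, hj⟩ := h1
      have hj0 : 0 < j := by
        by_contra! hneg
        have : (lam : ℤ) * j ≤ 0 := mul_nonpos_of_nonneg_of_nonpos (by omega) hneg
        linarith
      lift j to ℕ using hj0.le
      refine ⟨j, by exact_mod_cast hj0, ?_, ?_⟩
      · rw [hdiv', ← hj]
        push_cast [show 1 ≤ q by omega]
        linarith
      · have : (lam : ℤ) * s = lam * ((A + j * Q : ℕ) : ℤ) := by
          push_cast at h ⊢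
          linear_combination h - hA' + Q * hj
        exact_mod_cast mul_left_cancel₀ (by positivity) this
    · rintro ⟨j, hj0, hj, rfl⟩
      rw [hdiv'] at hj
      push_cast [show 1 ≤ q by omega] at hj
      refine ⟨q + lam * j, ?_, ?_, ?_⟩
      · have : (0 : ℤ) < lam * j := by positivity
        linarith
      · linarith
      · push_cast
        linear_combination hA'
  · rw [hdiv]
    push_cast
    constructor <;> intro h <;> linarith

end Leaders

/-! ### Counting the leaders in `[1, D]` -/

section Counting

/-- The number of terms among the first `k` of the progression `u, u + Q, …` that are at
most `D`. -/
def progressionCount (u Q k D : ℕ) : ℕ :=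
  ((Finset.range k).filter fun j => u + j * Q ≤ D).card

/-- For `a > 0`, `h1` says that the term of index `a - 1` is at most `D`, written without
subtraction. -/
theorem progressionCount_eq {u Q k D a : ℕ} (hak : a ≤ k) (h1 : a = 0 ∨ u + a * Q ≤ D + Q)
    (h2 : a = k ∨ D < u + a * Q) : progressionCount u Q k D = a := by
  have : (Finset.range k).filter (fun j => u + j * Q ≤ D) = Finset.range a := by
    ext j
    simp only [Finset.mem_filter, Finset.mem_range]
    constructor
    · rintro ⟨hj, hjD⟩
      rcases h2 with rfl | h2
      · exact hj
      · by_contra! h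
        have := Nat.mul_le_mul_right Q h
        omega
    · intro hj
      refine ⟨by omega, ?_⟩
      have h3 := Nat.mul_le_mul_right Q (show j + 1 ≤ a from hj)
      rw [add_mul, one_mul] at h3
      omega
  rw [progressionCount, this, Finset.card_range]

theorem card_image_progression (u Q k D : ℕ) (hQ : 0 < Q) :
    (((Finset.range k).filter fun j => u + j * Q ≤ D).image fun j => u + j * Q).card =
      progressionCount u Q k D := by
  refine Finset.card_image_of_injective _ fun i j h => ?_
  exact Nat.eq_of_mul_eq_mul_right hQ (by simpa using h)

/-- The numerical data of the length `n = (q ^ (2t+1) + 1) / lam`. -/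
structure LengthData (q lam t n A B : ℕ) : Prop where
  three_le : 3 ≤ q
  two_le : 2 ≤ t
  even : Even t
  two_le_lam : 2 ≤ lam
  dvd : lam ∣ q + 1
  mul_n : lam * n = q ^ (2 * t + 1) + 1
  mul_A : lam * A = q * q ^ t + 1
  mul_B : lam * B + 2 = 2 * q ^ t

namespace LengthData

variable {q lam t n A B : ℕ}

theorem two_mul_add_three_le (h : LengthData q lam t n A B) : 2 * q + 3 ≤ q ^ t := by
  have h1 : q ^ 2 ≤ q ^ t := Nat.pow_le_pow_right (by have := h.three_le; omega) h.two_le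
  have := h.three_le
  nlinarith

theorem B_lt (h : LengthData q lam t n A B) : B < q ^ t := by
  have h1 := h.mul_B
  have h2 := Nat.mul_le_mul_right B h.two_le_lam
  omega

theorem div_lt_B (h : LengthData q lam t n A B) : (q - 2) / lam < B := by
  refine lt_of_mul_lt_mul_left ?_ (Nat.zero_le lam)
  have h1 := h.mul_B
  have h2 := Nat.mul_div_le (q - 2) lam
  have h3 := h.two_mul_add_three_le
  omega

theorem div_lt_A (h : LengthData q lam t n A B) : q / lam < A := by
  refine lt_of_mul_lt_mul_left ?_ (Nat.zero_le lam)
  have h1 := h.mul_A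
  have h2 := Nat.mul_div_le q lam
  have h3 := h.two_mul_add_three_le
  have h4 := Nat.mul_le_mul_left q (show 1 ≤ q ^ t by omega)
  omega

/-- The progression `A + B + jQ` ends before the final block, which starts at `κ = 2A - ⌊(2q + 1) /
λ⌋`. -/
theorem lt_of_second (h : LengthData q lam t n A B) :
    A + B + (q - 3) / lam * q ^ t + (2 * q + 1) / lam < 2 * A := by
  refine lt_of_mul_lt_mul_left ?_ (Nat.zero_le lam)
  have h1 := h.mul_A
  have h2 := h.mul_B
  have h3 := Nat.mul_le_mul_right (q ^ t) (Nat.mul_div_le (q - 3) lam)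
  have h4 := Nat.mul_div_le (2 * q + 1) lam
  have h5 := h.two_mul_add_three_le
  have h6 : (q - 3) * q ^ t + 3 * q ^ t = q * q ^ t := by
    rw [← add_mul, Nat.sub_add_cancel h.three_le]
  have h7 : lam * (A + B + (q - 3) / lam * q ^ t + (2 * q + 1) / lam) =
      lam * A + lam * B + lam * ((q - 3) / lam) * q ^ t + lam * ((2 * q + 1) / lam) := by ring
  have h8 : lam * (2 * A) = 2 * (lam * A) := by ring
  omega

theorem lt_of_third (h : LengthData q lam t n A B) :
    A + (q - 1) / lam * q ^ t + (2 * q + 1) / lam < 2 * A := by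
  refine lt_of_mul_lt_mul_left ?_ (Nat.zero_le lam)
  have h0 := h.three_le
  have h1 := h.mul_A
  have h3 := Nat.mul_le_mul_right (q ^ t) (Nat.mul_div_le (q - 1) lam)
  have h4 := Nat.mul_div_le (2 * q + 1) lam
  have h5 := h.two_mul_add_three_le
  have h6 : (q - 1) * q ^ t + q ^ t = q * q ^ t := by
    rw [← Nat.succ_mul]
    congr 1
    omega
  have h7 : lam * (A + (q - 1) / lam * q ^ t + (2 * q + 1) / lam) =
      lam * A + lam * ((q - 1) / lam) * q ^ t + lam * ((2 * q + 1) / lam) := by ring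
  have h8 : lam * (2 * A) = 2 * (lam * A) := by ring
  omega

theorem mul_lt_of_lt (h : LengthData q lam t n A B) {D : ℕ} (hD : D + (2 * q + 1) / lam < 2 * A) :
    lam * D + 1 ≤ 2 * q * q ^ t + 2 * q := by
  have h0 := h.three_le
  have h1 := h.mul_A
  have h2 := Nat.mul_le_mul_left lam (show D + 1 ≤ 2 * A from (Nat.le_add_right D _).trans_lt hD)
  have h3 : lam * (2 * A) = 2 * (q * q ^ t + 1) := by rw [← h1]; ring
  have h4 := h.two_le_lam
  rw [h3, mul_add] at h2
  rw [mul_assoc]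
  omega

theorem not_isCosetLeader_iff (h : LengthData q lam t n A B) {s : ℕ} (hs : 1 ≤ s)
    (hqs : ¬ q ∣ s) (hsX : lam * s + 1 ≤ 2 * q * q ^ t + 2 * q) :
    ¬ IsCosetLeader q n s ↔ (A ≤ s + q / lam ∧ s ≤ A + (q - 2) / lam) ∨
      (∃ j ≤ (q - 3) / lam, s = A + B + j * q ^ t) ∨
      (∃ j, 1 ≤ j ∧ j ≤ (q - 1) / lam ∧ s = A + j * q ^ t) ∨
      2 * A ≤ s + (2 * q + 1) / lam := by
  have h1 := h.two_le_lam
  rw [_root_.not_isCosetLeader_iff h.three_le h.two_le (by omega) h.dvd h.mul_n hs hqs hsX,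
    ← isExceptional_mul_iff h.three_le h.two_le_lam h.dvd
      (by push_cast; exact dvd_pow_even_sub_one h.dvd h.even) h.mul_A h.mul_B]
  push_cast
  rfl

/-- Ensures that nothing is counted twice with the multiples of `q`. In the block the only multiple
of `q` is `qQ`, which `λ` does not divide; on the progressions `λ s ≡ ± 1` modulo `q`. -/
theorem not_dvd_of_exceptional (h : LengthData q lam t n A B) {s : ℕ}
    (hs : (A ≤ s + q / lam ∧ s ≤ A + (q - 2) / lam) ∨
      (∃ j ≤ (q - 3) / lam, s = A + B + j * q ^ t) ∨
      (∃ j, 1 ≤ j ∧ j ≤ (q - 1) / lam ∧ s = A + j * q ^ t)) : ¬ q ∣ s := by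
  rintro hq
  have h3 := h.three_le
  have hlam := h.two_le_lam
  have hqs : (q : ℤ) ∣ (lam * s : ℕ) := by exact_mod_cast hq.mul_left lam
  have hqQ : (q : ℤ) ∣ (q ^ t : ℕ) := by
    exact_mod_cast dvd_pow_self q (by have := h.two_le; omega)
  have hA := h.mul_A
  have hcop := coprime_of_dvd_add_one h.dvd
  have hunit : ∀ e : ℤ, 0 < |e| → |e| < q → ¬ (q : ℤ) ∣ e := fun e h0 h1 h2 => by
    have := Int.eq_zero_of_abs_lt_dvd h2 h1
    simp [this] at h0
  have hone : ¬ (q : ℤ) ∣ 1 := hunit 1 (by norm_num) (by norm_num; omega)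
  rcases hs with ⟨h1, h2⟩ | ⟨j, hj, rfl⟩ | ⟨j, hj1, hj, rfl⟩
  · have h4 := Nat.mul_div_le q lam
    have h5 := Nat.mul_div_le (q - 2) lam
    have h6 := Nat.mul_le_mul_left lam h1
    have h7 := Nat.mul_le_mul_left lam h2
    rw [mul_add] at h6 h7
    have h8 : ((lam * s : ℕ) : ℤ) - q * (q ^ t : ℕ) = 0 := by
      refine Int.eq_zero_of_abs_lt_dvd (dvd_sub hqs (dvd_mul_right (q : ℤ) _)) ?_
      rw [abs_lt]
      have h8 : ((q - 2 : ℕ) : ℤ) = q - 2 := by push_cast [show 2 ≤ q by omega]; rfl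
      zify at h4 h5 h6 h7 hA
      push_cast
      constructor <;> linarith
    have h9 : lam * s = q * q ^ t := by zify; push_cast at h8; linarith
    have h10 : lam ∣ q ^ (t + 1) := ⟨s, by rw [h9, pow_succ']⟩
    have := Nat.Coprime.eq_one_of_dvd (hcop.pow_right (t + 1)) h10
    omega
  · refine hone ?_
    have hB := h.mul_B
    have : (1 : ℤ) = (q + 2 + lam * j) * (q ^ t : ℕ) -
        ((lam * (A + B + j * q ^ t) : ℕ) : ℤ) := by
      zify at hA hB
      push_cast
      linear_combination hA + hB
    rw [this]
    exact dvd_sub (hqQ.mul_left _) hqs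
  · refine hone ?_
    have : (1 : ℤ) = ((lam * (A + j * q ^ t) : ℕ) : ℤ) - (q + lam * j) * (q ^ t : ℕ) := by
      zify at hA
      push_cast
      linear_combination -hA
    rw [this]
    exact dvd_sub hqs (hqQ.mul_left _)

/-- The number of coset leaders below the last block of exceptions. -/
theorem numLeaders_add (h : LengthData q lam t n A B) {D : ℕ}
    (hD : D + (2 * q + 1) / lam < 2 * A) :
    numLeaders q n D + D / q + (min D (A + (q - 2) / lam) + 1 - (A - q / lam)) +
      progressionCount (A + B) (q ^ t) ((q - 3) / lam + 1) D +
      progressionCount (A + q ^ t) (q ^ t) ((q - 1) / lam) D = D := by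
  classical
  have hQ := h.two_mul_add_three_le
  have hB := h.B_lt
  have hfB := h.div_lt_B
  have hfA := h.div_lt_A
  have hf0 := Nat.zero_le ((q - 2) / lam)
  have hq := h.three_le
  set Q := q ^ t with hQdef
  set M := (Finset.Ioc 0 D).filter fun s => q ∣ s with hM
  set E₁ := Finset.Icc (A - q / lam) (min D (A + (q - 2) / lam)) with hE₁
  set E₂ := ((Finset.range ((q - 3) / lam + 1)).filter fun j => A + B + j * Q ≤ D).image
    fun j => A + B + j * Q with hE₂
  set E₃ := ((Finset.range ((q - 1) / lam)).filter fun j => A + Q + j * Q ≤ D).image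
    fun j => A + Q + j * Q with hE₃
  have mem₁ : ∀ s, s ∈ E₁ ↔ s ≤ D ∧ A ≤ s + q / lam ∧ s ≤ A + (q - 2) / lam := fun s => by
    rw [hE₁, Finset.mem_Icc]; omega
  have mem₂ : ∀ s, s ∈ E₂ ↔ s ≤ D ∧ ∃ j ≤ (q - 3) / lam, s = A + B + j * Q := fun s => by
    simp only [hE₂, Finset.mem_image, Finset.mem_filter, Finset.mem_range]
    constructor
    · rintro ⟨j, ⟨hj, hjD⟩, rfl⟩
      exact ⟨hjD, j, by omega, rfl⟩
    · rintro ⟨hsD, j, hj, rfl⟩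
      exact ⟨j, ⟨by omega, hsD⟩, rfl⟩
  have mem₃ : ∀ s, s ∈ E₃ ↔ s ≤ D ∧ ∃ j, 1 ≤ j ∧ j ≤ (q - 1) / lam ∧ s = A + j * Q := fun s => by
    simp only [hE₃, Finset.mem_image, Finset.mem_filter, Finset.mem_range]
    constructor
    · rintro ⟨j, ⟨hj, hjD⟩, rfl⟩
      exact ⟨hjD, j + 1, by omega, by omega, by ring⟩
    · rintro ⟨hsD, j, hj1, hj, rfl⟩
      obtain ⟨i, rfl⟩ := Nat.exists_eq_add_of_le hj1
      have : A + Q + i * Q = A + (1 + i) * Q := by ring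
      exact ⟨i, ⟨by omega, by rwa [this]⟩, this⟩
  have memM : ∀ s, s ∈ M ↔ (1 ≤ s ∧ s ≤ D) ∧ q ∣ s := fun s => by
    rw [hM, Finset.mem_filter, Finset.mem_Ioc, Nat.succ_le_iff]
  have hnon : (Finset.Icc 1 D).filter (fun s => ¬ IsCosetLeader q n s) =
      ((M ∪ E₁) ∪ E₂) ∪ E₃ := by
    ext s
    rw [Finset.mem_filter, Finset.mem_Icc, Finset.mem_union, Finset.mem_union, Finset.mem_union,
      mem₁, mem₂, mem₃, memM]
    constructor
    · rintro ⟨⟨hs1, hsD⟩, hs⟩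
      by_cases hqs : q ∣ s
      · exact Or.inl (Or.inl (Or.inl ⟨⟨hs1, hsD⟩, hqs⟩))
      rcases (h.not_isCosetLeader_iff hs1 hqs (h.mul_lt_of_lt (by omega))).1 hs with
        hs | hs | hs | hs
      · exact Or.inl (Or.inl (Or.inr ⟨hsD, hs⟩))
      · exact Or.inl (Or.inr ⟨hsD, hs⟩)
      · exact Or.inr ⟨hsD, hs⟩
      · omega
    · have key : ∀ s, s ≤ D → ((A ≤ s + q / lam ∧ s ≤ A + (q - 2) / lam) ∨
          (∃ j ≤ (q - 3) / lam, s = A + B + j * Q) ∨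
          (∃ j, 1 ≤ j ∧ j ≤ (q - 1) / lam ∧ s = A + j * Q)) →
          (1 ≤ s ∧ s ≤ D) ∧ ¬ IsCosetLeader q n s := fun s hsD hs => by
        have hqs := h.not_dvd_of_exceptional hs
        have hs1 : 1 ≤ s := by
          by_contra! h0
          obtain rfl : s = 0 := by omega
          exact hqs (dvd_zero q)
        refine ⟨⟨hs1, hsD⟩, (h.not_isCosetLeader_iff hs1 hqs (h.mul_lt_of_lt (by omega))).2 ?_⟩
        rcases hs with hs | hs | hs
        · exact Or.inl hs
        · exact Or.inr (Or.inl hs)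
        · exact Or.inr (Or.inr (Or.inl hs))
      rintro (((⟨hs1, hqs⟩ | ⟨hsD, hs⟩) | ⟨hsD, hs⟩) | ⟨hsD, hs⟩)
      · exact ⟨hs1, not_isCosetLeader_of_dvd (by omega) hs1.1 hqs⟩
      · exact key s hsD (Or.inl hs)
      · exact key s hsD (Or.inr (Or.inl hs))
      · exact key s hsD (Or.inr (Or.inr hs))
  have hd₁ : Disjoint M E₁ := Finset.disjoint_left.2 fun s h1 h2 =>
    h.not_dvd_of_exceptional (Or.inl ((mem₁ s).1 h2).2) ((memM s).1 h1).2
  have hd₂ : Disjoint (M ∪ E₁) E₂ := Finset.disjoint_left.2 fun s h1 h2 => by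
    have h2 := ((mem₂ s).1 h2).2
    rcases Finset.mem_union.1 h1 with h1 | h1
    · exact h.not_dvd_of_exceptional (Or.inr (Or.inl h2)) ((memM s).1 h1).2
    · obtain ⟨j, -, rfl⟩ := h2
      have := ((mem₁ _).1 h1).2.2
      omega
  have hd₃ : Disjoint ((M ∪ E₁) ∪ E₂) E₃ := Finset.disjoint_left.2 fun s h1 h2 => by
    have h2 := ((mem₃ s).1 h2).2
    rcases Finset.mem_union.1 h1 with h1 | h1
    · rcases Finset.mem_union.1 h1 with h1 | h1
      · exact h.not_dvd_of_exceptional (Or.inr (Or.inr h2)) ((memM s).1 h1).2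
      · obtain ⟨j, hj1, -, rfl⟩ := h2
        have h3 := ((mem₁ _).1 h1).2.2
        have := Nat.mul_le_mul_right Q hj1
        omega
    · obtain ⟨j, hj1, -, rfl⟩ := h2
      obtain ⟨-, i, -, h3⟩ := (mem₂ _).1 h1
      -- The two progressions interleave without meeting, since `0 < B < Q`.
      rcases le_or_gt j i with hji | hji
      · have := Nat.mul_le_mul_right Q hji
        omega
      · have := Nat.mul_le_mul_right Q (show i + 1 ≤ j from hji)
        rw [add_mul] at this
        omega
  have hcard := congrArg Finset.card hnon
  rw [Finset.card_union_of_disjoint hd₃, Finset.card_union_of_disjoint hd₂,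
    Finset.card_union_of_disjoint hd₁, hM, Nat.Ioc_filter_dvd_card_eq_div, hE₁, Nat.card_Icc, hE₂,
    card_image_progression _ _ _ _ (by omega), hE₃,
    card_image_progression _ _ _ _ (by omega)] at hcard
  have htot := Finset.card_filter_add_card_filter_not (s := Finset.Icc 1 D)
    (fun s => IsCosetLeader q n s)
  rw [hcard, Nat.card_Icc] at htot
  rw [numLeaders]
  omega

/-- No further coset leaders occur in the last block. -/
theorem numLeaders_eq_of_le (h : LengthData q lam t n A B) {D : ℕ}
    (hD : 2 * A ≤ D + (2 * q + 1) / lam) (hDX : lam * D + 1 ≤ 2 * q * q ^ t + 2 * q) :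
    numLeaders q n D = numLeaders q n (2 * A - (2 * q + 1) / lam - 1) := by
  classical
  rw [numLeaders, numLeaders]
  congr 1
  ext s
  simp only [Finset.mem_filter, Finset.mem_Icc]
  refine and_congr_left fun hs => and_congr_right fun hs1 => ?_
  constructor
  · intro hsD
    by_contra! hc
    refine absurd hs ?_
    by_cases hqs : q ∣ s
    · exact not_isCosetLeader_of_dvd (by have := h.three_le; omega) hs1 hqs
    · refine (h.not_isCosetLeader_iff hs1 hqs ?_).2 (Or.inr (Or.inr (Or.inr (by omega))))
      have := Nat.mul_le_mul_left lam hsD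
      omega
  · intro hsD
    have := h.lt_of_third
    omega

end LengthData

end Counting

/-! ### Parameters of the codes and values of the leader count -/

namespace LengthData

variable {q lam t n A B : ℕ}

theorem n_pos (h : LengthData q lam t n A B) : 0 < n := by
  have := h.mul_n
  rcases Nat.eq_zero_or_pos n with rfl | hn
  · rw [mul_zero] at this; omega
  · exact hn

theorem coprime (h : LengthData q lam t n A B) : Nat.Coprime n q := by
  have h1 : Nat.Coprime (q ^ (2 * t + 1) + 1) q := by
    rw [pow_succ']
    simp
  exact h1.coprime_dvd_left ⟨lam, by rw [← h.mul_n, mul_comm]⟩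

theorem pow_modEq_one (h : LengthData q lam t n A B) : q ^ (2 * (2 * t + 1)) ≡ 1 [MOD n] := by
  have h1 : (n : ℤ) ∣ (q : ℤ) ^ (2 * t + 1) + 1 := ⟨lam, by
    have := h.mul_n
    zify at this
    rw [← this, mul_comm]⟩
  refine ((Nat.modEq_iff_dvd).2 ?_).symm
  push_cast
  exact h1.trans ⟨(q : ℤ) ^ (2 * t + 1) - 1, by ring⟩

theorem dvd_pow_add_one (h : LengthData q lam t n A B) : n ∣ q ^ (2 * t + 1) + 1 :=
  ⟨lam, by rw [← h.mul_n, mul_comm]⟩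

theorem pow_eq (t : ℕ) (q : ℕ) : q ^ (2 * t + 1) + 1 = q * (q ^ t * q ^ t) + 1 := by ring

/-- Yields both `D < n` and `D < (q^m + 1) / (q + 1)`. -/
theorem lt_of_mul_le (h : LengthData q lam t n A B) {D : ℕ}
    (hD : lam * D + 1 ≤ 2 * q * q ^ t + 2 * q) : D * (q + 1) < q ^ (2 * t + 1) + 1 := by
  have h1 := h.two_mul_add_three_le
  have h2 := h.three_le
  have h3 := Nat.mul_le_mul_right D h.two_le_lam
  have h4 : D ≤ q * (q ^ t + 1) := by rw [mul_assoc] at hD; nlinarith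
  have h5 := Nat.mul_le_mul_right (q + 1) h4
  rw [pow_eq]
  have h6 : q * ((q ^ t + 1) * (q + 1)) ≤ q * (q ^ t * q ^ t) := by
    refine Nat.mul_le_mul_left q ?_
    nlinarith
  rw [mul_assoc] at h5
  omega

/-- The number `(q ^ (2t+1) + 1) / (q + 1)` lies in no small cyclotomic coset. -/
theorem exists_notMem_cosets (h : LengthData q lam t n A B) (hlt : lam < q + 1) {D : ℕ}
    (hD : lam * D + 1 ≤ 2 * q * q ^ t + 2 * q) :
    ∃ z < n, ∀ j < D + 1, ∀ l, ¬ z ≡ j * q ^ l [MOD n] := by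
  have h1 : q + 1 ∣ q ^ (2 * t + 1) + 1 := by
    have := Odd.nat_add_dvd_pow_add_pow q 1 (⟨t, rfl⟩ : Odd (2 * t + 1))
    simpa using this
  obtain ⟨M, hM⟩ := h1
  obtain ⟨c, hc⟩ := h.dvd
  have hlam := h.two_le_lam
  have hn : n = M * c := by
    have h2 := h.mul_n
    rw [hM, hc, mul_assoc] at h2
    rw [Nat.eq_of_mul_eq_mul_left (by omega) h2, mul_comm]
  have hM0 : 0 < M := by
    rcases Nat.eq_zero_or_pos M with rfl | hM0
    · rw [mul_zero] at hM; omega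
    · exact hM0
  -- Here `λ < q + 1` is essential: it makes `M = n / c` a nonzero residue modulo `n`. As `M` is
  -- prime to `q`, `M ≡ j q^l` would give `M ∣ j` with `j < M`, so `j = 0`.
  have hc2 : 2 ≤ c := by
    by_contra! hc2
    interval_cases c <;> omega
  have hMn : M < n := by rw [hn]; nlinarith
  have hDM : D < M := by
    have h3 := h.lt_of_mul_le hD
    rw [hM, mul_comm (q + 1)] at h3
    exact lt_of_mul_lt_mul_right h3 (Nat.zero_le _)
  refine ⟨M, hMn, fun j hj l hl => ?_⟩
  have hMdvd : M ∣ j * q ^ l := by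
    have h4 : M ≡ j * q ^ l [MOD M] := hl.of_dvd ⟨c, hn⟩
    exact Nat.modEq_zero_iff_dvd.1 (h4.symm.trans (Nat.modEq_zero_iff_dvd.2 dvd_rfl))
  have hcop : Nat.Coprime M q := h.coprime.coprime_dvd_left ⟨c, hn⟩
  have h5 := (hcop.pow_right l).dvd_of_dvd_mul_right hMdvd
  have h6 : j = 0 := Nat.eq_zero_of_dvd_of_lt h5 (by omega)
  rw [h6, zero_mul] at hl
  have := Nat.eq_zero_of_dvd_of_lt (Nat.modEq_zero_iff_dvd.1 hl) hMn
  omega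

/-- The parameters of the two BCH codes in terms of the number of coset leaders. -/
theorem bchCode_parameters {F : Type*} [Field F] [Fintype F] {K : Type*} [Field K] [Algebra F K]
    {β : K} (hq : q = Fintype.card F) (h : LengthData q lam t n A B) (hlt : lam < q + 1)
    (hβ : IsPrimitiveRoot β n) {D : ℕ}
    (hDX : lam * D + 1 ≤ 2 * q * q ^ t + 2 * q) (k : ℤ)
    (hk : k = n - 2 * (2 * t + 1 : ℕ) * numLeaders q n D) :
    IsLCD (bchCode F n β (D + 1) 1) ∧
      (∃ d : ℕ, D + 1 ≤ d ∧ HasParameters (bchCode F n β (D + 1) 1) k d) ∧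
      IsLCD (bchCode F n β (D + 1 + 1) 0) ∧
      (∃ d : ℕ, 2 * (D + 1) ≤ d ∧ HasParameters (bchCode F n β (D + 1 + 1) 0) (k - 1) d) := by
  classical
  have hn0 := h.n_pos
  have hdvd : n ∣ Fintype.card F ^ (2 * t + 1) + 1 := hq ▸ h.dvd_pow_add_one
  have hnF : (n : F) ≠ 0 := by
    intro h0
    obtain ⟨c, hc⟩ := hdvd
    have := congrArg (Nat.cast (R := F)) hc
    push_cast at this
    rw [h0, FiniteField.cast_card_eq_zero, zero_pow (by omega)] at this
    simp at this
  have hlam := h.two_le_lam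
  have hDn : D < n := by
    have h1 := h.lt_of_mul_le hDX
    rw [← h.mul_n] at h1
    have h2 := Nat.mul_le_mul_right n (show lam ≤ q + 1 by omega)
    rw [mul_comm] at h1
    exact lt_of_mul_lt_mul_left (h1.trans_le h2) (Nat.zero_le _)
  have hcard := card_biUnion_cosets hn0 h.coprime (r := 2 * (2 * t + 1)) (by omega)
    h.pow_modEq_one (D := D) fun s hs hsD l hl0 hl =>
      not_mul_pow_modEq_self h.three_le h.two_le (by omega) h.mul_n hs
        (by have := Nat.mul_le_mul_left lam hsD; omega) hl0 hl
  have hcard0 := card_biUnion_cosets_zero hn0 h.coprime hDn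
  have hdeg₁ := natDegree_bchGenerator hn0 hnF hβ (D + 1) 1
  have hdeg₀ := natDegree_bchGenerator hn0 hnF hβ (D + 1 + 1) 0
  simp only [Nat.add_sub_cancel, ← hq] at hdeg₁ hdeg₀
  rw [hcard] at hdeg₁ hcard0
  rw [hcard0] at hdeg₀
  have hfin₁ := finrank_cyclicCode hn0
    (bchGenerator_dvd_X_pow_sub_one (F := F) hβ.pow_eq_one (D + 1) 1)
  have hfin₀ := finrank_cyclicCode hn0
    (bchGenerator_dvd_X_pow_sub_one (F := F) hβ.pow_eq_one (D + 1 + 1) 0)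
  -- Strictness keeps both codes nonzero, so that a minimum distance exists.
  have hlt₀ : 2 * (2 * t + 1) * numLeaders q n D + 1 < n := by
    obtain ⟨z, hz, hz'⟩ := h.exists_notMem_cosets hlt hDX
    rw [← hcard0]
    conv_rhs => rw [← Finset.card_range n]
    refine Finset.card_lt_card (Finset.filter_ssubset.2 ⟨z, Finset.mem_range.2 hz, ?_⟩)
    rintro ⟨j, hj, l, hl⟩
    rw [zero_add] at hl
    exact hz' j hj l hl
  have hne : ∀ δ b, 0 < Module.finrank F (bchCode F n β δ b) → bchCode F n β δ b ≠ ⊥ := by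
    intro δ b h0 hbot
    rw [hbot, finrank_bot] at h0
    exact lt_irrefl _ h0
  rw [hdeg₁] at hfin₁
  rw [hdeg₀] at hfin₀
  change Module.finrank F (bchCode F n β (D + 1) 1) + _ = n at hfin₁
  change Module.finrank F (bchCode F n β (D + 1 + 1) 0) + _ = n at hfin₀
  have hk' : k = n - ((2 * (2 * t + 1) * numLeaders q n D : ℕ) : ℤ) := by rw [hk]; push_cast; ring
  refine ⟨isLCD_bchCode hn0 hdvd hβ _ _, ?_, isLCD_bchCode hn0 hdvd hβ _ _, ?_⟩
  · obtain ⟨d, hd, hmin⟩ := exists_isMinDistance (bchCode F n β (D + 1) 1)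
      (hne _ _ (by omega)) (D + 1)
      (fun c hc hc0 _ => le_hammingNorm_bchCode hn0 hβ hc hc0)
    exact ⟨d, hd, by omega, hmin⟩
  · obtain ⟨d, hd, hmin⟩ := exists_isMinDistance (bchCode F n β (D + 1 + 1) 0)
      (hne _ _ (by omega)) (2 * (D + 1))
      (fun c hc hc0 _ => two_mul_le_hammingNorm_bchCode hn0 hβ hdvd (by omega) hc hc0)
    exact ⟨d, hd, by omega, hmin⟩

/-! Values of `numLeaders` on the successive ranges of `D`. -/

theorem numLeaders_of_lt (h : LengthData q lam t n A B) {D : ℕ} (hD : D + q / lam < A) :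
    numLeaders q n D + D / q = D := by
  have h1 := h.lt_of_third
  have h2 := h.B_lt
  have h3 := h.numLeaders_add (D := D) (by
    have := Nat.zero_le ((q - 1) / lam * q ^ t)
    have := Nat.zero_le (q / lam)
    omega)
  have h4 := Nat.zero_le (q / lam)
  rw [progressionCount_eq (a := 0) (Nat.zero_le _) (Or.inl rfl) (Or.inr (by omega)),
    progressionCount_eq (a := 0) (Nat.zero_le _) (Or.inl rfl) (Or.inr (by omega))] at h3
  generalize D / q = e, q / lam = f, (q - 2) / lam = f', (2 * q + 1) / lam = f'' at *
  omega

theorem numLeaders_of_mem_block (h : LengthData q lam t n A B) {D : ℕ} (hD : A ≤ D + q / lam)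
    (hD' : D ≤ A + (q - 2) / lam) : numLeaders q n D + D / q + (D + 1 + q / lam) = D + A := by
  have h1 := h.lt_of_second
  have h2 := h.B_lt
  have h4 := h.div_lt_B
  have h5 := h.div_lt_A
  have h3 := h.numLeaders_add (D := D) (by omega)
  rw [progressionCount_eq (a := 0) (Nat.zero_le _) (Or.inl rfl) (Or.inr (by omega)),
    progressionCount_eq (a := 0) (Nat.zero_le _) (Or.inl rfl) (Or.inr (by omega))] at h3
  generalize D / q = e, q / lam = f, (q - 2) / lam = f', (2 * q + 1) / lam = f'' at *
  omega

/-- Past the block around `A`, `a` and `b` count the terms up to `D` of `A + B + jQ` (`j ≥ 0`) and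
of `A + jQ` (`j ≥ 1`). -/
theorem numLeaders_of_ge (h : LengthData q lam t n A B) {D a b : ℕ}
    (hD : A + (q - 2) / lam ≤ D) (hDκ : D + (2 * q + 1) / lam < 2 * A)
    (ha : a ≤ (q - 3) / lam + 1) (hb : b ≤ (q - 1) / lam)
    (ha1 : a = 0 ∨ A + B + a * q ^ t ≤ D + q ^ t)
    (ha2 : a = (q - 3) / lam + 1 ∨ D < A + B + a * q ^ t)
    (hb1 : b = 0 ∨ A + b * q ^ t ≤ D)
    (hb2 : b = (q - 1) / lam ∨ D < A + (b + 1) * q ^ t) :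
    numLeaders q n D + D / q + ((q - 2) / lam + q / lam + 1) + a + b = D := by
  have h5 := h.div_lt_A
  have h3 := h.numLeaders_add hDκ
  rw [add_mul] at hb2
  rw [progressionCount_eq ha ha1 ha2,
    progressionCount_eq hb (hb1.imp_right fun _ => by omega) (hb2.imp_right fun _ => by omega)] at h3
  generalize D / q = e, q / lam = f, (q - 2) / lam = f', (2 * q + 1) / lam = f'' at *
  omega

end LengthData

/-! ### Floors, ceilings and the final case analysis -/

theorem floor_natCast_sub_div (q c lam : ℕ) (h : c ≤ q) :
    ⌊((q : ℚ) - c) / lam⌋ = (((q - c) / lam : ℕ) : ℤ) := by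
  rw [← Nat.cast_sub h, Rat.floor_natCast_div_natCast]
  rfl

/-- Identifies `ε`, and `τ` at `κ - 1`, as the number of non-multiples of `q` in `[1, D]`. -/
theorem ceil_mul_one_sub_inv (D q : ℕ) (hq : 0 < q) :
    ⌈(D : ℚ) * (1 - (q : ℚ)⁻¹)⌉ = D - ((D / q : ℕ) : ℤ) := by
  have : (D : ℚ) * (1 - (q : ℚ)⁻¹) = D + -((D : ℚ) / q) := by
    field_simp
    ring
  rw [this, Int.ceil_natCast_add, Int.ceil_neg, Rat.floor_natCast_div_natCast]
  rfl

theorem exists_lengthData {q lam t n : ℕ} (hq : 3 ≤ q) (ht2 : 2 ≤ t) (ht : Even t)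
    (hlam : lam ∣ q + 1) (hlam2 : 2 ≤ lam) (hn : n = (q ^ (2 * t + 1) + 1) / lam) :
    ∃ A B, LengthData q lam t n A B := by
  have h0 : lam ∣ q ^ t - 1 := by
    have h1 := dvd_pow_even_sub_one hlam ht
    have h2 : 1 ≤ q ^ t := Nat.one_le_pow _ _ (by omega)
    have h3 : ((q ^ t - 1 : ℕ) : ℤ) = (q : ℤ) ^ t - 1 := by push_cast [h2]; rfl
    exact_mod_cast h3 ▸ h1
  have h2 : 1 ≤ q ^ t := Nat.one_le_pow _ _ (by omega)
  obtain ⟨i, hi⟩ := h0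
  obtain ⟨e, he⟩ := hlam
  have hN : lam ∣ q ^ (2 * t + 1) + 1 := by
    have := Odd.nat_add_dvd_pow_add_pow q 1 (⟨t, rfl⟩ : Odd (2 * t + 1))
    exact Dvd.dvd.trans ⟨e, he⟩ (by simpa using this)
  have hQ : q ^ t = lam * i + 1 := by omega
  refine ⟨q * i + e, 2 * i, hq, ht2, ht, hlam2, ⟨e, he⟩, ?_, ?_, ?_⟩
  · rw [hn, Nat.mul_div_cancel' hN]
  · rw [hQ, mul_add, ← he]; ring
  · rw [hQ]; ring

theorem theorem3 {F : Type*} [Field F] [Fintype F] {K : Type*} [Field K] [Algebra F K]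
    (q lam m t n δ : ℕ) (β : K)
    (hq : q = Fintype.card F) (hq_odd : Odd q)
    (hlam_dvd : lam ∣ q + 1) (hlam_two : 2 ≤ lam) (hlam_lt : lam < q + 1)
    (hm : m = 2 * t + 1) (hm_five : 5 ≤ m) (ht : Even t)
    (hn : n = (q ^ m + 1) / lam) (hβ : IsPrimitiveRoot β n)
    (hδ_lower : 1 ≤ (δ : ℚ) - 1)
    (hδ_upper : (δ : ℚ) - 1 ≤ (2 * (q : ℚ) ^ (t + 1) + 2 * q - 1) / lam)
    -- `A = (q^(t+1) + 1) / λ` and `B = 2 (q^t - 1) / λ`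
    (A B κ : ℚ) (ε υ τ : ℤ)
    (hA : A = ((q : ℚ) ^ (t + 1) + 1) / lam)
    (hB : B = 2 * ((q : ℚ) ^ t - 1) / lam)
    (hε : ε = ⌈((δ : ℚ) - 1) * (1 - (q : ℚ)⁻¹)⌉)
    (hυ : υ = ⌊((q : ℚ) - 2) / lam⌋ + ⌊(q : ℚ) / lam⌋)
    (hκ : κ = 2 * A - ⌊(2 * (q : ℚ) + 1) / lam⌋)
    (hτ : τ = ⌈(κ - 1) * (1 - (q : ℚ)⁻¹)⌉) :
    ∃ k : ℤ,
      IsLCD (bchCode F n β δ 1) ∧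
      (∃ d : ℕ, δ ≤ d ∧ HasParameters (bchCode F n β δ 1) k d) ∧
      IsLCD (bchCode F n β (δ + 1) 0) ∧
      (∃ d : ℕ, 2 * δ ≤ d ∧ HasParameters (bchCode F n β (δ + 1) 0) (k - 1) d) ∧
      -- (1)
      (2 ≤ δ → (δ : ℚ) ≤ A + B →
        ((δ : ℚ) ≤ A - ⌊(q : ℚ) / lam⌋ → k = n - 2 * m * ε) ∧
        (A - ⌊(q : ℚ) / lam⌋ < δ → (δ : ℚ) ≤ A + ⌊((q : ℚ) - 2) / lam⌋ →
          (k : ℚ) = n - 2 * m * ε + 2 * m * (δ - A + ⌊(q : ℚ) / lam⌋)) ∧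
        (A + ⌊((q : ℚ) - 2) / lam⌋ < δ → k = n - 2 * m * (ε - υ - 1))) ∧
      -- (2)
      (⌊((q : ℚ) - 3) / lam⌋ ≠ 0 → A + B < δ →
        (δ : ℚ) ≤ A + B + ⌊((q : ℚ) - 3) / lam⌋ * (q : ℚ) ^ t →
        ∀ a : ℤ, 0 ≤ a → a ≤ ⌊((q : ℚ) - 3) / lam⌋ - 1 →
          (A + B + a * (q : ℚ) ^ t < δ → (δ : ℚ) ≤ A + (a + 1) * (q : ℚ) ^ t →
            k = n - 2 * m * (ε - υ - 2 * a - 2)) ∧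
          (A + (a + 1) * (q : ℚ) ^ t < δ → (δ : ℚ) ≤ A + B + (a + 1) * (q : ℚ) ^ t →
            k = n - 2 * m * (ε - υ - 2 * a - 3))) ∧
      -- (3)
      (A + B + ⌊((q : ℚ) - 3) / lam⌋ * (q : ℚ) ^ t < δ →
        (δ : ℚ) ≤ (2 * (q : ℚ) ^ (t + 1) + 2 * q - 1) / lam + 1 →
        -- (i)
        (⌊((q : ℚ) - 1) / lam⌋ = ⌊((q : ℚ) - 3) / lam⌋ →
          ((δ : ℚ) ≤ κ → k = n - 2 * m * (ε - υ - 2 * ⌊((q : ℚ) - 1) / lam⌋ - 2)) ∧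
          (κ < δ → k = n - 2 * m * (τ - υ - 2 * ⌊((q : ℚ) - 1) / lam⌋ - 2))) ∧
        -- (ii)
        (⌊((q : ℚ) - 1) / lam⌋ = ⌊((q : ℚ) - 3) / lam⌋ + 1 →
          ((δ : ℚ) ≤ A + ⌊((q : ℚ) - 1) / lam⌋ * (q : ℚ) ^ t →
            k = n - 2 * m * (ε - υ - 2 * ⌊((q : ℚ) - 1) / lam⌋)) ∧
          (A + ⌊((q : ℚ) - 1) / lam⌋ * (q : ℚ) ^ t < δ → (δ : ℚ) ≤ κ →
            k = n - 2 * m * (ε - υ - 2 * ⌊((q : ℚ) - 1) / lam⌋ - 1)) ∧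
          (κ < δ → k = n - 2 * m * (τ - υ - 2 * ⌊((q : ℚ) - 1) / lam⌋ - 1)))) := by
  have hq3 : 3 ≤ q := by
    have h1 : 1 < q := hq ▸ Fintype.one_lt_card
    obtain ⟨r, hr⟩ := hq_odd
    omega
  subst hm
  obtain ⟨A', B', h⟩ := exists_lengthData hq3 (by omega) ht hlam_dvd hlam_two hn
  have hlam0 : (0 : ℚ) < lam := by exact_mod_cast (by omega : 0 < lam)
  obtain rfl : A = A' := by
    rw [hA, div_eq_iff hlam0.ne', pow_succ', mul_comm (A' : ℚ)]
    exact_mod_cast h.mul_A.symm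
  obtain rfl : B = B' := by
    rw [hB, div_eq_iff hlam0.ne', mul_comm (B' : ℚ)]
    have : ((lam * B' + 2 : ℕ) : ℚ) = ((2 * q ^ t : ℕ) : ℚ) := by rw [h.mul_B]
    push_cast at this
    linarith
  obtain ⟨D, rfl⟩ : ∃ D, δ = D + 1 := by
    refine Nat.exists_eq_add_of_le' ?_
    have : (1 : ℚ) ≤ δ := by linarith
    exact_mod_cast this
  have hDX : lam * D + 1 ≤ 2 * q * q ^ t + 2 * q := by
    rw [le_div_iff₀ hlam0] at hδ_upper
    have : ((lam * D + 1 : ℕ) : ℚ) ≤ ((2 * q * q ^ t + 2 * q : ℕ) : ℚ) := by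
      push_cast at hδ_upper ⊢
      rw [pow_succ] at hδ_upper
      linarith
    exact_mod_cast this
  have hf₀ : ⌊(q : ℚ) / lam⌋ = ((q / lam : ℕ) : ℤ) := by
    rw [Rat.floor_natCast_div_natCast]; rfl
  have hf₁ := floor_natCast_sub_div q 1 lam (by omega)
  have hf₂ := floor_natCast_sub_div q 2 lam (by omega)
  have hf₃ := floor_natCast_sub_div q 3 lam (by omega)
  have hf₄ : ⌊(2 * (q : ℚ) + 1) / lam⌋ = (((2 * q + 1) / lam : ℕ) : ℤ) := by
    have := Rat.floor_natCast_div_natCast (2 * q + 1) lam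
    push_cast at this ⊢
    exact this
  simp only [Nat.cast_one, Nat.cast_ofNat] at hf₁ hf₂ hf₃
  have hκA := h.lt_of_third
  have hκB := h.lt_of_second
  have hBQ := h.B_lt
  have hfB := h.div_lt_B
  have hκ' : κ = ((2 * A' - (2 * q + 1) / lam : ℕ) : ℚ) := by
    rw [hκ, hf₄, Nat.cast_sub (by omega)]
    push_cast
    rfl
  have hε' : ε = D - ((D / q : ℕ) : ℤ) := by
    rw [hε, ← ceil_mul_one_sub_inv D q (by omega)]
    push_cast
    rw [add_sub_cancel_right]
  set E := 2 * A' - (2 * q + 1) / lam - 1 with hE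
  have hτ' : τ = E - ((E / q : ℕ) : ℤ) := by
    rw [hτ, ← ceil_mul_one_sub_inv E q (by omega), hκ', hE, Nat.cast_sub (n := 2 * A' - _) (by omega)]
    push_cast
    rfl
  rw [hf₂, hf₀] at hυ
  set k : ℤ := n - 2 * (2 * t + 1 : ℕ) * numLeaders q n D with hk
  have key : ∀ e : ℤ, (numLeaders q n D : ℤ) = e → k = n - 2 * (2 * t + 1 : ℕ) * e :=
    fun e he => by rw [hk, he]
  obtain ⟨hc₁, hc₂, hc₃, hc₄⟩ := h.bchCode_parameters hq hlam_lt hβ hDX k hk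
  have hN₁ := h.numLeaders_of_lt (D := D)
  have hN₂ := h.numLeaders_of_mem_block (D := D)
  have hN₃ := fun a b => h.numLeaders_of_ge (D := D) (a := a) (b := b)
  have hN₄ := fun a b => h.numLeaders_of_ge (D := E) (a := a) (b := b)
  have hN₅ := h.numLeaders_eq_of_le (D := D)
  rw [← hE] at hN₅
  have hf₃₁ : (q - 3) / lam ≤ (q - 1) / lam := Nat.div_le_div_right (by omega)
  have hE1 : E + 1 + (2 * q + 1) / lam = 2 * A' := by omega
  have hκE : κ = (E : ℚ) + 1 := by
    rw [hκ', hE, Nat.cast_sub (n := 2 * A' - _) (by omega)]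
    push_cast
    ring
  refine ⟨k, hc₁, hc₂, hc₃, hc₄, ?_⟩
  rw [hf₀, hf₁, hf₂, hf₃, hε', hτ', hυ, hκE]
  clear_value E k
  clear hc₁ hc₂ hc₃ hc₄ hk hf₀ hf₁ hf₂ hf₃ hf₄ hε hτ hυ hκ hκ' hε' hτ' hE hκE hδ_lower hδ_upper hA hB
  -- With the quotients opaque, the remaining cases are linear arithmetic once the terms of the
  -- progressions below `D` are counted.
  generalize q / lam = f₀, (q - 1) / lam = f₁, (q - 2) / lam = f₂, (q - 3) / lam = f₃,
    (2 * q + 1) / lam = f₄, D / q = d, E / q = e at *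
  have hmul : ∀ {a b : ℕ}, a ≤ b → a * q ^ t ≤ b * q ^ t := fun h => Nat.mul_le_mul_right _ h
  have hsucc : ∀ a : ℕ, (a + 1) * q ^ t = a * q ^ t + q ^ t := fun a => by ring
  have hcast : ∀ {x y : ℕ}, (x : ℚ) ≤ y → x ≤ y := fun h => by exact_mod_cast h
  have hcast' : ∀ {x y : ℕ}, (x : ℚ) < y → x < y := fun h => by exact_mod_cast h
  refine ⟨?_, ?_, ?_⟩
  · intro _ hDB
    have hDB' : D + 1 ≤ A' + B' := hcast (by push_cast at hDB ⊢; linarith)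
    refine ⟨fun h₁ => ?_, fun h₁ h₂ => ?_, fun h₁ => ?_⟩
    · have h₁' : D + 1 + f₀ ≤ A' := hcast (by push_cast at h₁ ⊢; linarith)
      have := hN₁ (by omega)
      exact key _ (by omega)
    · have h₁' : A' < D + 1 + f₀ := hcast' (by push_cast at h₁ ⊢; linarith)
      have h₂' : D + 1 ≤ A' + f₂ := hcast (by push_cast at h₂ ⊢; linarith)
      have := hN₂ (by omega) (by omega)
      -- Inside the block, `D + 1 + f₀ - A'` of its elements are at most `D`.
      have hk' := key (D - d - (D + 1 + f₀ - A')) (by omega)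
      rw [hk']
      push_cast
      ring
    · have h₁' : A' + f₂ < D + 1 := hcast' (by push_cast at h₁ ⊢; linarith)
      have := hN₃ 0 0 (by omega) (by omega) (Nat.zero_le _) (Nat.zero_le _) (Or.inl rfl)
        (Or.inr (by omega)) (Or.inl rfl) (Or.inr (by omega))
      exact key _ (by omega)
  · intro _ _ _ a ha0 ha
    lift a to ℕ using ha0
    have haf : a + 1 ≤ f₃ := by omega
    have hm₁ := hmul haf
    have hm₂ := hmul hf₃₁
    have hs := hsucc a
    have hs' := hsucc (a + 1)
    refine ⟨fun h₁ h₂ => ?_, fun h₁ h₂ => ?_⟩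
    · have h₁' : A' + B' + a * q ^ t < D + 1 := hcast' (by push_cast at h₁ ⊢; linarith)
      have h₂' : D + 1 ≤ A' + (a + 1) * q ^ t := hcast (by push_cast at h₂ ⊢; linarith)
      -- Passed so far: `A + B + jQ` for `0 ≤ j ≤ a` and `A + jQ` for `1 ≤ j ≤ a`.
      have := hN₃ (a + 1) a (by omega) (by omega) (by omega) (by omega) (Or.inr (by omega))
        (Or.inr (by omega)) (Or.inr (by omega)) (Or.inr (by omega))
      exact key _ (by omega)
    · have h₁' : A' + (a + 1) * q ^ t < D + 1 := hcast' (by push_cast at h₁ ⊢; linarith)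
      have h₂' : D + 1 ≤ A' + B' + (a + 1) * q ^ t := hcast (by push_cast at h₂ ⊢; linarith)
      have := hN₃ (a + 1) (a + 1) (by omega) (by omega) (by omega) (by omega) (Or.inr (by omega))
        (Or.inr (by omega)) (Or.inr (by omega)) (Or.inr (by omega))
      exact key _ (by omega)
  · intro h₀ _
    have h₀' : A' + B' + f₃ * q ^ t < D + 1 := hcast' (by push_cast at h₀ ⊢; linarith)
    have hs := hsucc f₃
    refine ⟨fun hf => ⟨fun h₁ => ?_, fun h₁ => ?_⟩,
      fun hf => ⟨fun h₁ => ?_, fun h₁ h₂ => ?_, fun h₁ => ?_⟩⟩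
    · obtain rfl : f₁ = f₃ := by omega
      have h₁' : D + 1 ≤ E + 1 := hcast (by push_cast at h₁ ⊢; linarith)
      have := hN₃ (f₁ + 1) f₁ (by omega) (by omega) le_rfl le_rfl (Or.inr (by omega))
        (Or.inl rfl) (Or.inr (by omega)) (Or.inl rfl)
      exact key _ (by omega)
    · obtain rfl : f₁ = f₃ := by omega
      have h₁' : E + 1 < D + 1 := hcast' (by push_cast at h₁ ⊢; linarith)
      -- Beyond `κ` the count is evaluated at `E = κ - 1`, where it became constant.
      have := hN₄ (f₁ + 1) f₁ (by omega) (by omega) le_rfl le_rfl (Or.inr (by omega))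
        (Or.inl rfl) (Or.inr (by omega)) (Or.inl rfl)
      have hEq := hN₅ (by omega) hDX
      exact key _ (by omega)
    · obtain rfl : f₁ = f₃ + 1 := by omega
      have h₁' : D + 1 ≤ A' + (f₃ + 1) * q ^ t := hcast (by push_cast at h₁ ⊢; linarith)
      have := hN₃ (f₃ + 1) f₃ (by omega) (by omega) le_rfl (by omega) (Or.inr (by omega))
        (Or.inl rfl) (Or.inr (by omega)) (Or.inr (by omega))
      exact key _ (by omega)
    · obtain rfl : f₁ = f₃ + 1 := by omega
      have h₁' : A' + (f₃ + 1) * q ^ t < D + 1 := hcast' (by push_cast at h₁ ⊢; linarith)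
      have h₂' : D + 1 ≤ E + 1 := hcast (by push_cast at h₂ ⊢; linarith)
      have := hN₃ (f₃ + 1) (f₃ + 1) (by omega) (by omega) le_rfl le_rfl (Or.inr (by omega))
        (Or.inl rfl) (Or.inr (by omega)) (Or.inl rfl)
      exact key _ (by omega)
    · obtain rfl : f₁ = f₃ + 1 := by omega
      have h₁' : E + 1 < D + 1 := hcast' (by push_cast at h₁ ⊢; linarith)
      have := hN₄ (f₃ + 1) (f₃ + 1) (by omega) (by omega) le_rfl le_rfl (Or.inr (by omega))
        (Or.inl rfl) (Or.inr (by omega)) (Or.inl rfl)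
      have hEq := hN₅ (by omega) hDX
      exact key _ (by omega)
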